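/- Let $q,\beta\in\mathbb C$ with $0<|q|<|\beta|^2<1$. Put $(a;q)_\infty=\prod_{j\ge0}(1-aq^j)$ and $(a;q)_k=(a;q)_\infty/(aq^k;q)_\infty$ for $a\in\mathbb C$, $k\in\mathbb Z$. As usual, $(a_1,\dots,a_m;q)_\infty=(a_1;q)_\infty\cdots(a_m;q)_\infty$ and $(ae^{\pm 2\mathrm i\theta};q)_\infty=(ae^{2\mathrm i\theta},ae^{-2\mathrm i\theta};q)_\infty$. For parameters $b,\gamma\in\mathbb C\setminus\{0\}$ and $n\in\mathbb Z$ the bilateral $q$-ultraspherical function is $$C_n(x;b,\gamma\,|\,q)=\sum_{k=-\infty}^{\infty}\frac{(b\gamma;q)_k\,(b\gamma;q)_{n-k}}{(q\gamma;q)_k\,(q\gamma;q)_{n-k}}\,e^{\mathrm i(n-2k)\theta},\qquad x=\cos\theta,$$ for $|qe^{\pm2\mathrm i\theta}/b|<1$. Then for every $n\in\mathbb Z$ the series defining $C_n(x;\beta^2,1/\beta\,|\,q)$ converges absolutely for every $x=\cos\theta\in[-1,1]$, the integrand below is integrable on $[-1,1]$, and $$\frac1{2\pi}\int_{-1}^1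 C_n(x;\beta^2,1/\beta\,|\,q)\,\frac{(e^{\pm2\mathrm i\theta};q)_\infty}{(\beta e^{\pm2\mathrm i\theta};q)_\infty}\,\frac{\mathrm dx}{\sqrt{1-x^2}}=\frac{(q;q)_\infty^2\,(\beta,q/\beta^2;q)_\infty}{(q/\beta;q)_\infty^3\,(\beta^2;q)_\infty}\,\delta_{n,0},$$ where $x=\cos\theta$ and $\delta_{n,0}$ is $1$ for $n=0$ and $0$ otherwise. -/

import Mathlib

noncomputable section

/-- The infinite `q`-shifted factorial `(a;q)_∞ = ∏_{j ≥ 0} (1 - a q^j)`. -/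
def qFactInf (a q : ℂ) : ℂ := ∏' j : ℕ, (1 - a * q ^ j)

/-- The `q`-shifted factorial `(a;q)_k = (a;q)_∞ / (a q^k;q)_∞` for an integer `k`. -/
def qFact (a q : ℂ) (k : ℤ) : ℂ := qFactInf a q / qFactInf (a * q ^ k) q

/-- The `k`-th term of the bilateral series that defines the bilateral
`q`-ultraspherical function `C_n(x; β, γ | q)` at `x = cos θ`. -/
def bilateralTerm (q β γ : ℂ) (n : ℤ) (θ : ℂ) (k : ℤ) : ℂ :=
  (qFact (β * γ) q k * qFact (β * γ) q (n - k)) /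
    (qFact (q * γ) q k * qFact (q * γ) q (n - k)) *
    Complex.exp (Complex.I * ((n : ℂ) - 2 * (k : ℂ)) * θ)

/-- The bilateral `q`-ultraspherical function `C_n(x; β, γ | q)` as a function of `x`:
the sum of the bilateral series at some `θ` with `cos θ = x`. The value does not depend on
the choice of `θ`, see `bilateralUltraspherical_cos`. -/
def bilateralUltraspherical (q β γ : ℂ) (n : ℤ) (x : ℂ) : ℂ :=
  ∑' k : ℤ, bilateralTerm q β γ n (Function.surjInv Complex.cos_surjective x) k

/-- `C_n(cos θ; β, γ | q)` is the sum of the bilateral series at `θ`, for every complex `θ`. -/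
theorem bilateralUltraspherical_cos (q β γ : ℂ) (n : ℤ) (θ : ℂ) :
    bilateralUltraspherical q β γ n (Complex.cos θ) = ∑' k : ℤ, bilateralTerm q β γ n θ k := by
  unfold bilateralUltraspherical
  have h := Function.surjInv_eq Complex.cos_surjective (Complex.cos θ)
  generalize Function.surjInv Complex.cos_surjective (Complex.cos θ) = φ at h
  obtain ⟨m, hm | hm⟩ := Complex.cos_eq_cos_iff.1 h
  · refine tsum_congr fun k => ?_
    unfold bilateralTerm
    congr 1
    rw [Complex.exp_eq_exp_iff_exists_int]
    refine ⟨-(m * (n - 2 * k)), ?_⟩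
    rw [hm]; push_cast; ring
  · rw [← (Equiv.subLeft n).tsum_eq]
    refine tsum_congr fun k => ?_
    unfold bilateralTerm
    simp only [Equiv.subLeft_apply, sub_sub_cancel]
    rw [mul_comm (qFact (β * γ) q (n - k)), mul_comm (qFact (q * γ) q (n - k))]
    congr 1
    rw [Complex.exp_eq_exp_iff_exists_int]
    refine ⟨-(m * (n - 2 * k)), ?_⟩
    rw [hm]; push_cast; ring

/-- The factor `(e^{± 2iθ};q)_∞ / (β e^{± 2iθ};q)_∞` of the continuous `q`-ultraspherical
weight at `x = cos θ ∈ [-1, 1]`. -/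
def ultrasphericalRatio (q β : ℂ) (x : ℝ) : ℂ :=
  let e : ℂ := Complex.exp (2 * Complex.I * (Real.arccos x : ℂ))
  let e' : ℂ := Complex.exp (-(2 * Complex.I * (Real.arccos x : ℂ)))
  (qFactInf e q * qFactInf e' q) / (qFactInf (β * e) q * qFactInf (β * e') q)

end

/-! Write c_k = (β;q)_k/(q/β;q)_k. With z = e^{2iθ} the weight becomes w(z) =
(z,1/z;q)_∞/(βz,β/z;q)_∞, and C_n = Σ c_k c_{n-k} e^{i(n-2k)θ}. Since c_{-k} = (q/β²)^k c_k, the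
series is dominated uniformly in θ and may be integrated termwise over [0,π]. For odd n the
integrand changes sign under θ ↦ π-θ. For n = 2m, centring at k = m+j leaves π Σ_j c_{m+j} c_{m-j}
w_j, where w_j are the Laurent coefficients of w on |z| = 1.

These come from the kernel K = (z,q/z;q)_∞/(βz,β/z;q)_∞, for which w = (1-1/z)K. A contour shift z ↦
qz gives a first-order recurrence for K_j (`laurentCoeff_ultraKernel_succ`). The constant K_0 is
found by letting β ↦ qβ ↦ q²β ↦ ... → 0 and comparing with β = q, where K = 1-z
(`laurentCoeff_ultraKernel_zero`).

With these w_j the sum over j is twice a multiple of a very-well-poised ₆φ₅ with a = 1 and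
parameters 1/β, βq^{-M}, βq^M, M = |m| (`bilateralCoeff_mul_eq_wellPoised`,
`tsum_bilateralCoeff_mul_laurentCoeff`). Its product evaluation `wellPoisedSum_eq` contains
(q^{1-M};q)_∞, which is zero unless M = 0; this is the Kronecker delta. The ₆φ₅ sum itself follows
from a telescoping q-difference equation in the reciprocal e of one parameter, iterated down to e =
0 and normalised at e = 1. -/

open Filter Topology

noncomputable section

/-! ### Finite and infinite q-shifted factorials: splitting, non-vanishing, analyticity, bounds -/

/-- The finite `q`-shifted factorial `(a;q)_k = ∏_{i < k} (1 - a q^i)`. -/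
def qFactFin (a q : ℂ) (k : ℕ) : ℂ := ∏ i ∈ Finset.range k, (1 - a * q ^ i)

theorem qFactFin_zero (a q : ℂ) : qFactFin a q 0 = 1 := by simp [qFactFin]

theorem qFactFin_succ (a q : ℂ) (k : ℕ) :
    qFactFin a q (k + 1) = qFactFin a q k * (1 - a * q ^ k) := by
  simp [qFactFin, Finset.prod_range_succ]

theorem qFactFin_add (a q : ℂ) (m k : ℕ) :
    qFactFin a q (m + k) = qFactFin a q m * qFactFin (a * q ^ m) q k := by
  simp only [qFactFin, Finset.prod_range_add]
  congr 1
  exact Finset.prod_congr rfl fun i _ => by ring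

theorem qFactFin_ne_zero {a q : ℂ} (h : ∀ i : ℕ, 1 - a * q ^ i ≠ 0) (k : ℕ) :
    qFactFin a q k ≠ 0 :=
  Finset.prod_ne_zero_iff.2 fun i _ => h i

theorem summable_norm_neg_mul_pow (a : ℂ) {q : ℂ} (hq : ‖q‖ < 1) :
    Summable fun j : ℕ => ‖-(a * q ^ j)‖ := by
  simpa using (summable_geometric_of_lt_one (norm_nonneg q) hq).mul_left ‖a‖

theorem qFactInf_eq_tprod_one_add (a q : ℂ) :
    qFactInf a q = ∏' j : ℕ, (1 + -(a * q ^ j)) := by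
  simp [qFactInf, sub_eq_add_neg]

theorem multipliable_one_sub_mul_pow (a : ℂ) {q : ℂ} (hq : ‖q‖ < 1) :
    Multipliable fun j : ℕ => 1 - a * q ^ j := by
  simpa [sub_eq_add_neg] using
    multipliable_one_add_of_summable (summable_norm_neg_mul_pow a hq)

theorem tendsto_qFactFin (a : ℂ) {q : ℂ} (hq : ‖q‖ < 1) :
    Tendsto (qFactFin a q) atTop (𝓝 (qFactInf a q)) :=
  (multipliable_one_sub_mul_pow a hq).hasProd.tendsto_prod_nat

theorem qFactInf_ne_zero {a q : ℂ} (hq : ‖q‖ < 1) (h : ∀ i : ℕ, 1 - a * q ^ i ≠ 0) :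
    qFactInf a q ≠ 0 := by
  rw [qFactInf_eq_tprod_one_add]
  exact tprod_one_add_ne_zero_of_summable (fun i => by simpa [sub_eq_add_neg] using h i)
    (summable_norm_neg_mul_pow a hq)

theorem one_sub_mul_pow_ne_zero {a q : ℂ} (hq : ‖q‖ < 1) (ha : ‖a‖ < 1) (i : ℕ) :
    1 - a * q ^ i ≠ 0 := by
  intro h
  have h1 : ‖a * q ^ i‖ = 1 := by rw [← sub_eq_zero.1 h, norm_one]
  rw [norm_mul, norm_pow] at h1
  have h2 : ‖a‖ * ‖q‖ ^ i ≤ ‖a‖ :=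
    mul_le_of_le_one_right (norm_nonneg a) (pow_le_one₀ (norm_nonneg q) hq.le)
  linarith

theorem qFactInf_ne_zero_of_norm_lt_one {a q : ℂ} (hq : ‖q‖ < 1) (ha : ‖a‖ < 1) :
    qFactInf a q ≠ 0 :=
  qFactInf_ne_zero hq (one_sub_mul_pow_ne_zero hq ha)

theorem qFactInf_eq_qFactFin_mul (a : ℂ) {q : ℂ} (hq : ‖q‖ < 1) (k : ℕ) :
    qFactInf a q = qFactFin a q k * qFactInf (a * q ^ k) q := by
  have h1 := (tendsto_qFactFin (a * q ^ k) hq).const_mul (qFactFin a q k)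
  simp only [← qFactFin_add] at h1
  have h2 := (tendsto_add_atTop_iff_nat k).2 (tendsto_qFactFin a hq)
  simp only [add_comm _ k] at h2
  exact tendsto_nhds_unique h2 h1

theorem qFactInf_eq_one_sub_mul (a : ℂ) {q : ℂ} (hq : ‖q‖ < 1) :
    qFactInf a q = (1 - a) * qFactInf (a * q) q := by
  simpa [qFactFin] using qFactInf_eq_qFactFin_mul a hq 1

theorem qFactInf_zero_left (q : ℂ) : qFactInf 0 q = 1 := by simp [qFactInf]

theorem qFactInf_one_left {q : ℂ} (hq : ‖q‖ < 1) : qFactInf 1 q = 0 := by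
  rw [qFactInf_eq_one_sub_mul 1 hq]; simp

/-- On a ball of radius `‖a‖ + 1` the factors deviate from 1 by at most a geometric sequence, so the
polynomial partial products converge locally uniformly. Holomorphy is what later permits the contour
shift. -/
theorem differentiable_qFactInf {q : ℂ} (hq : ‖q‖ < 1) :
    Differentiable ℂ fun a => qFactInf a q := by
  intro a
  have hU : IsOpen (Metric.ball (0 : ℂ) (‖a‖ + 1)) := Metric.isOpen_ball
  have h := Summable.hasProdLocallyUniformlyOn_nat_one_add (f := fun (j : ℕ) (x : ℂ) => -(x * q ^ j))
    hU (u := fun j => (‖a‖ + 1) * ‖q‖ ^ j)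
    ((summable_geometric_of_lt_one (norm_nonneg q) hq).mul_left _)
    (Eventually.of_forall fun j x hx => by
      rw [norm_neg, norm_mul, norm_pow]
      have : ‖x‖ < ‖a‖ + 1 := by simpa using hx
      gcongr) (fun j => by fun_prop)
  have h' : DifferentiableOn ℂ (fun x => ∏' j : ℕ, (1 + -(x * q ^ j)))
      (Metric.ball (0 : ℂ) (‖a‖ + 1)) := by
    refine TendstoLocallyUniformlyOn.differentiableOn h
      (Eventually.of_forall fun s => ?_) hU
    fun_prop
  simp only [qFactInf_eq_tprod_one_add]
  exact h'.differentiableAt (hU.mem_nhds (by simp))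

theorem continuous_qFactInf {q : ℂ} (hq : ‖q‖ < 1) : Continuous fun a => qFactInf a q :=
  (differentiable_qFactInf hq).continuous

theorem exists_norm_qFactFin_le (a : ℂ) {q : ℂ} (hq : ‖q‖ < 1) :
    ∃ C > 0, ∀ k, ‖qFactFin a q k‖ ≤ C := by
  obtain ⟨C, hC⟩ := (tendsto_qFactFin a hq).norm.bddAbove_range
  exact ⟨max C 1, by positivity, fun k => (hC ⟨k, rfl⟩).trans (le_max_left _ _)⟩

theorem exists_norm_inv_qFactFin_le {a q : ℂ} (hq : ‖q‖ < 1) (h : ∀ i : ℕ, 1 - a * q ^ i ≠ 0) :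
    ∃ C > 0, ∀ k, ‖(qFactFin a q k)⁻¹‖ ≤ C := by
  obtain ⟨C, hC⟩ := ((tendsto_qFactFin a hq).inv₀ (qFactInf_ne_zero hq h)).norm.bddAbove_range
  exact ⟨max C 1, by positivity, fun k => (hC ⟨k, rfl⟩).trans (le_max_left _ _)⟩

/-! ### The very-well-poised ₆φ₅ summation with a = 1 -/

/-- The part of the summand of the well-poised series `₆φ₅` (with `a = 1`) that does not depend
on the third parameter. -/
def wellPoisedCoeff (q b c : ℂ) (k : ℕ) : ℂ :=
  (q / (b * c)) ^ k * (qFactFin b q k * qFactFin c q k) /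
    (qFactFin (q / b) q k * qFactFin (q / c) q k)

/-- `(d;q)_k d^{-k} / (q/d;q)_k` as a function of `e = 1/d`. -/
def wellPoisedRatio (q e : ℂ) (k : ℕ) : ℂ :=
  (∏ i ∈ Finset.range k, (e - q ^ i)) / qFactFin (q * e) q k

/-- The summand of the very-well-poised series `₆φ₅` with `a = 1` and parameters `b, c, 1/e`. -/
def wellPoisedTerm (q b c e : ℂ) (k : ℕ) : ℂ :=
  (1 + q ^ k) * wellPoisedCoeff q b c k * wellPoisedRatio q e k

/-- The very-well-poised series `₆φ₅` with `a = 1` and parameters `b, c, 1/e`. -/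
def wellPoisedSum (q b c e : ℂ) : ℂ := 1 + ∑' k : ℕ, wellPoisedTerm q b c e (k + 1)

theorem wellPoisedRatio_succ (q e : ℂ) (k : ℕ) :
    wellPoisedRatio q e (k + 1) =
      wellPoisedRatio q e k * ((e - q ^ k) / (1 - q ^ (k + 1) * e)) := by
  rw [wellPoisedRatio, wellPoisedRatio, qFactFin_succ, Finset.prod_range_succ,
    mul_div_mul_comm, show q * e * q ^ k = q ^ (k + 1) * e by ring]

theorem wellPoisedCoeff_succ (q b c : ℂ) (k : ℕ) :
    wellPoisedCoeff q b c (k + 1) = wellPoisedCoeff q b c k *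
      (q / (b * c) * ((1 - b * q ^ k) * (1 - c * q ^ k)) /
        ((1 - q ^ (k + 1) / b) * (1 - q ^ (k + 1) / c))) := by
  simp only [wellPoisedCoeff, qFactFin_succ]
  rw [show q / b * q ^ k = q ^ (k + 1) / b by ring, show q / c * q ^ k = q ^ (k + 1) / c by ring]
  simp only [div_eq_mul_inv, mul_inv]
  ring

/-- Since qe - q^{i+1} = q(e - q^i), all numerator factors but the first return to those at `e`; the
denominators (q²e;q)_{k+1} and (qe;q)_k differ only in end factors. Hence the series at `e` and at
`q * e` can be telescoped against each other. -/
theorem wellPoisedRatio_mul_left {q e : ℂ} (he : ∀ i : ℕ, 1 - q ^ (i + 1) * e ≠ 0) (k : ℕ) :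
    wellPoisedRatio q (q * e) (k + 1) = wellPoisedRatio q e k *
      (q ^ k * (q * e - 1) * (1 - q * e) /
        ((1 - q ^ (k + 1) * e) * (1 - q ^ (k + 2) * e))) := by
  induction k with
  | zero =>
    have h0 := he 0
    have h1 := he 1
    simp [wellPoisedRatio, qFactFin] at h0 h1 ⊢
    rw [show 1 - q * (q * e) = 1 - q ^ 2 * e by ring] at *
    field_simp
  | succ k ih =>
    have h0 := he k
    have h1 := he (k + 1)
    have h2 := he (k + 2)
    rw [wellPoisedRatio_succ q (q * e) (k + 1), ih, wellPoisedRatio_succ q e k]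
    rw [show 1 - q ^ (k + 1 + 1) * (q * e) = 1 - q ^ (k + 2 + 1) * e by ring]
    rw [show k + 1 + 1 = k + 2 by ring] at *
    rw [show k + 1 + 2 = k + 2 + 1 by ring] at *
    field_simp
    ring

/-- The telescoping relation behind the first order `q`-difference equation of
`wellPoisedSum`. -/
theorem wellPoised_partial_sum {q b c e : ℂ} (hb0 : b ≠ 0) (hc0 : c ≠ 0)
    (hb : ∀ i : ℕ, 1 - q ^ (i + 1) / b ≠ 0) (hc : ∀ i : ℕ, 1 - q ^ (i + 1) / c ≠ 0)
    (he : ∀ i : ℕ, 1 - q ^ (i + 1) * e ≠ 0) (N : ℕ) :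
    (1 - q * e) * (1 - q / (b * c) * e) *
        (1 + ∑ k ∈ Finset.range N, wellPoisedTerm q b c e (k + 1)) -
      (1 - q * e / b) * (1 - q * e / c) *
        (1 + ∑ k ∈ Finset.range N, wellPoisedTerm q b c (q * e) (k + 1)) =
    -e * (1 - q * e) * (q / (b * c)) * ((1 - b * q ^ N) * (1 - c * q ^ N)) *
      wellPoisedCoeff q b c N * wellPoisedRatio q e N / (1 - q ^ (N + 1) * e) := by
  induction N with
  | zero =>
    have h0 := he 0
    simp [wellPoisedCoeff, wellPoisedRatio, qFactFin] at h0 ⊢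
    field_simp
    ring
  | succ N ih =>
    rw [Finset.sum_range_succ, Finset.sum_range_succ, ← add_assoc, ← add_assoc,
      mul_add, mul_add _ _ (wellPoisedTerm q b c (q * e) (N + 1)), add_sub_add_comm, ih]
    simp only [wellPoisedTerm, wellPoisedRatio_mul_left he, wellPoisedRatio_succ,
      wellPoisedCoeff_succ]
    generalize wellPoisedCoeff q b c N = u
    generalize wellPoisedRatio q e N = v
    have h1 : 1 - q * q ^ N * e ≠ 0 := by simpa [pow_succ'] using he N
    have h2 : 1 - q * (q * q ^ N) * e ≠ 0 := by simpa [pow_succ'] using he (N + 1)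
    have h3 : b - q * q ^ N ≠ 0 := by
      have := hb N
      rw [one_sub_div hb0, pow_succ'] at this
      exact (div_ne_zero_iff.1 this).1
    have h4 : c - q * q ^ N ≠ 0 := by
      have := hc N
      rw [one_sub_div hc0, pow_succ'] at this
      exact (div_ne_zero_iff.1 this).1
    rw [one_sub_div hb0, one_sub_div hc0]
    simp only [pow_succ']
    clear ih
    generalize q ^ N = Q at *
    -- The denominators are kept as opaque letters while fractions are cleared and are restored only
    -- for the final polynomial identity.
    generalize hD1 : 1 - q * Q * e = D1 at *
    generalize hD2 : 1 - q * (q * Q) * e = D2 at *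
    generalize hD3 : b - q * Q = D3 at *
    generalize hD4 : c - q * Q = D4 at *
    field_simp
    subst hD1 hD2 hD3 hD4
    ring

/-- Uniformity in `N` is the point: it supplies the dominating series for the limit e → 0. The
denominator is a quotient (qe;q)_{N+k}/(qe;q)_N of quantities bounded above and away from 0. Each
numerator factor is at most ‖e‖(1 + ‖q‖^i/‖e‖), and the product of the brackets is the bounded real
factorial (-1/‖e‖;‖q‖)_k. -/
theorem exists_norm_wellPoisedRatio_le {q e : ℂ} (hq : ‖q‖ < 1) (he0 : e ≠ 0)
    (he : ∀ i : ℕ, 1 - q ^ (i + 1) * e ≠ 0) :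
    ∃ C > 0, ∀ N k : ℕ, ‖wellPoisedRatio q (q ^ N * e) k‖ ≤ C * ‖e‖ ^ k := by
  have he' : ∀ i : ℕ, 1 - q * e * q ^ i ≠ 0 := fun i => by
    rw [show q * e * q ^ i = q ^ (i + 1) * e by ring]; exact he i
  obtain ⟨A, hA, hA'⟩ := exists_norm_qFactFin_le (q * e) hq
  obtain ⟨B, hB, hB'⟩ := exists_norm_inv_qFactFin_le hq he'
  obtain ⟨D, hD, hD'⟩ := exists_norm_qFactFin_le (-(1 / ‖e‖ : ℝ) : ℂ) (q := (‖q‖ : ℂ))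
    (by simpa using hq)
  have hen : 0 < ‖e‖ := norm_pos_iff.2 he0
  refine ⟨D * (A * B), by positivity, fun N k => ?_⟩
  have hden : (qFactFin (q * (q ^ N * e)) q k)⁻¹ =
      qFactFin (q * e) q N * (qFactFin (q * e) q (N + k))⁻¹ := by
    rw [qFactFin_add, show q * e * q ^ N = q * (q ^ N * e) by ring, mul_inv,
      mul_inv_cancel_left₀ (qFactFin_ne_zero he' N)]
  have hnum : ‖∏ i ∈ Finset.range k, (q ^ N * e - q ^ i)‖ ≤ D * ‖e‖ ^ k := by
    calc ‖∏ i ∈ Finset.range k, (q ^ N * e - q ^ i)‖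
        = ∏ i ∈ Finset.range k, ‖q ^ N * e - q ^ i‖ := norm_prod _ _
      _ ≤ ∏ i ∈ Finset.range k, (‖1 - (-(1 / ‖e‖ : ℝ) : ℂ) * (‖q‖ : ℂ) ^ i‖ * ‖e‖) := by
          refine Finset.prod_le_prod (fun _ _ => norm_nonneg _) fun i _ => ?_
          have h1 : (1 - (-(1 / ‖e‖ : ℝ) : ℂ) * (‖q‖ : ℂ) ^ i) =
              ((1 + 1 / ‖e‖ * ‖q‖ ^ i : ℝ) : ℂ) := by push_cast; ring
          rw [h1, Complex.norm_of_nonneg (by positivity)]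
          calc ‖q ^ N * e - q ^ i‖ ≤ ‖q ^ N * e‖ + ‖q ^ i‖ := norm_sub_le _ _
            _ ≤ ‖e‖ + ‖q‖ ^ i := by
                rw [norm_mul, norm_pow, norm_pow]
                gcongr
                exact mul_le_of_le_one_left hen.le (pow_le_one₀ (norm_nonneg q) hq.le)
            _ = (1 + 1 / ‖e‖ * ‖q‖ ^ i) * ‖e‖ := by field_simp
      _ = ‖qFactFin (-(1 / ‖e‖ : ℝ) : ℂ) (‖q‖ : ℂ) k‖ * ‖e‖ ^ k := by
          rw [Finset.prod_mul_distrib, qFactFin, norm_prod]; simp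
      _ ≤ D * ‖e‖ ^ k := by gcongr; exact hD' k
  rw [wellPoisedRatio, div_eq_mul_inv, hden, norm_mul, norm_mul]
  calc _ ≤ (D * ‖e‖ ^ k) * (A * B) := by
        gcongr
        · exact hA' N
        · exact hB' _
    _ = _ := by ring

theorem exists_norm_wellPoisedCoeff_le {q b c : ℂ} (hq : ‖q‖ < 1)
    (hb : ∀ i : ℕ, 1 - q ^ (i + 1) / b ≠ 0) (hc : ∀ i : ℕ, 1 - q ^ (i + 1) / c ≠ 0) :
    ∃ C > 0, ∀ k : ℕ, ‖wellPoisedCoeff q b c k‖ ≤ C * ‖q / (b * c)‖ ^ k := by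
  obtain ⟨A, hA, hA'⟩ := exists_norm_qFactFin_le b hq
  obtain ⟨B, hB, hB'⟩ := exists_norm_qFactFin_le c hq
  obtain ⟨D, hD, hD'⟩ := exists_norm_inv_qFactFin_le (a := q / b) hq fun i => by
    rw [show q / b * q ^ i = q ^ (i + 1) / b by ring]; exact hb i
  obtain ⟨E, hE, hE'⟩ := exists_norm_inv_qFactFin_le (a := q / c) hq fun i => by
    rw [show q / c * q ^ i = q ^ (i + 1) / c by ring]; exact hc i
  refine ⟨A * B * (D * E), by positivity, fun k => ?_⟩
  rw [wellPoisedCoeff, div_eq_mul_inv, mul_inv, norm_mul, norm_mul, norm_mul, norm_mul, norm_pow]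
  calc _ ≤ ‖q / (b * c)‖ ^ k * (A * B) * (D * E) := by
        gcongr
        · exact hA' k
        · exact hB' k
        · exact hD' k
        · exact hE' k
    _ = _ := by ring

theorem exists_norm_wellPoised_mul_le {q b c e : ℂ} (hq : ‖q‖ < 1) (he0 : e ≠ 0)
    (hb : ∀ i : ℕ, 1 - q ^ (i + 1) / b ≠ 0) (hc : ∀ i : ℕ, 1 - q ^ (i + 1) / c ≠ 0)
    (he : ∀ i : ℕ, 1 - q ^ (i + 1) * e ≠ 0) :
    ∃ C > 0, ∀ N k : ℕ, ‖wellPoisedCoeff q b c k * wellPoisedRatio q (q ^ N * e) k‖ ≤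
      C * ‖q / (b * c) * e‖ ^ k := by
  obtain ⟨A, hA, hA'⟩ := exists_norm_wellPoisedCoeff_le hq hb hc
  obtain ⟨B, hB, hB'⟩ := exists_norm_wellPoisedRatio_le hq he0 he
  refine ⟨A * B, by positivity, fun N k => ?_⟩
  rw [norm_mul, norm_mul, mul_pow]
  calc _ ≤ (A * ‖q / (b * c)‖ ^ k) * (B * ‖e‖ ^ k) := by
        gcongr
        · exact hA' k
        · exact hB' N k
    _ = _ := by ring

theorem exists_norm_wellPoisedTerm_le {q b c e : ℂ} (hq : ‖q‖ < 1) (he0 : e ≠ 0)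
    (hb : ∀ i : ℕ, 1 - q ^ (i + 1) / b ≠ 0) (hc : ∀ i : ℕ, 1 - q ^ (i + 1) / c ≠ 0)
    (he : ∀ i : ℕ, 1 - q ^ (i + 1) * e ≠ 0) :
    ∃ C > 0, ∀ N k : ℕ, ‖wellPoisedTerm q b c (q ^ N * e) k‖ ≤
      C * ‖q / (b * c) * e‖ ^ k := by
  obtain ⟨C, hC, hC'⟩ := exists_norm_wellPoised_mul_le hq he0 hb hc he
  refine ⟨2 * C, by positivity, fun N k => ?_⟩
  rw [wellPoisedTerm, mul_assoc, norm_mul, mul_assoc 2]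
  gcongr
  · calc ‖1 + q ^ k‖ ≤ ‖(1 : ℂ)‖ + ‖q ^ k‖ := norm_add_le _ _
      _ ≤ 1 + 1 := by
        rw [norm_one, norm_pow]; gcongr; exact pow_le_one₀ (norm_nonneg q) hq.le
      _ = 2 := by norm_num
  · exact hC' N k

theorem summable_wellPoisedTerm {q b c e : ℂ} (hq : ‖q‖ < 1) (he0 : e ≠ 0)
    (hb : ∀ i : ℕ, 1 - q ^ (i + 1) / b ≠ 0) (hc : ∀ i : ℕ, 1 - q ^ (i + 1) / c ≠ 0)
    (he : ∀ i : ℕ, 1 - q ^ (i + 1) * e ≠ 0) (hX : ‖q / (b * c) * e‖ < 1) (N : ℕ) :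
    Summable fun k => wellPoisedTerm q b c (q ^ N * e) (k + 1) := by
  obtain ⟨C, hC, hC'⟩ := exists_norm_wellPoisedTerm_le hq he0 hb hc he
  refine (summable_nat_add_iff 1).2 ?_
  exact Summable.of_norm_bounded
    ((summable_geometric_of_lt_one (norm_nonneg _) hX).mul_left C) (hC' N)

/-- Limit of `wellPoised_partial_sum`: the boundary term is O(‖qe/(bc)‖^N) and disappears. -/
theorem wellPoisedSum_mul_left {q b c e : ℂ} (hq : ‖q‖ < 1) (hb0 : b ≠ 0) (hc0 : c ≠ 0)
    (he0 : e ≠ 0)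
    (hb : ∀ i : ℕ, 1 - q ^ (i + 1) / b ≠ 0) (hc : ∀ i : ℕ, 1 - q ^ (i + 1) / c ≠ 0)
    (he : ∀ i : ℕ, 1 - q ^ (i + 1) * e ≠ 0) (hX : ‖q / (b * c) * e‖ < 1) :
    (1 - q * e) * (1 - q / (b * c) * e) * wellPoisedSum q b c e =
      (1 - q * e / b) * (1 - q * e / c) * wellPoisedSum q b c (q * e) := by
  have s0 := (summable_wellPoisedTerm hq he0 hb hc he hX 0).hasSum.tendsto_sum_nat
  have s1 := (summable_wellPoisedTerm hq he0 hb hc he hX 1).hasSum.tendsto_sum_nat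
  simp only [pow_zero, one_mul, pow_one] at s0 s1
  have hL := ((s0.const_add 1).const_mul ((1 - q * e) * (1 - q / (b * c) * e))).sub
    ((s1.const_add 1).const_mul ((1 - q * e / b) * (1 - q * e / c)))
  simp only [wellPoised_partial_sum hb0 hc0 hb hc he] at hL
  obtain ⟨C, hC, hC'⟩ := exists_norm_wellPoised_mul_le hq he0 hb hc he
  have huv : Tendsto (fun k => wellPoisedCoeff q b c k * wellPoisedRatio q e k) atTop (𝓝 0) := by
    refine squeeze_zero_norm (fun k => by simpa using hC' 0 k) ?_
    simpa using (tendsto_pow_atTop_nhds_zero_of_lt_one (norm_nonneg _) hX).const_mul C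
  have hqk : Tendsto (fun k : ℕ => q ^ k) atTop (𝓝 0) :=
    tendsto_pow_atTop_nhds_zero_of_norm_lt_one hq
  have hR : Tendsto (fun N : ℕ => -e * (1 - q * e) * (q / (b * c)) *
      ((1 - b * q ^ N) * (1 - c * q ^ N)) * wellPoisedCoeff q b c N * wellPoisedRatio q e N /
        (1 - q ^ (N + 1) * e)) atTop (𝓝 (-e * (1 - q * e) * (q / (b * c)) *
      ((1 - b * 0) * (1 - c * 0)) * 0 / (1 - 0 * e))) := by
    have h1 := ((((hqk.const_mul b).const_sub 1).mul ((hqk.const_mul c).const_sub 1)).const_mul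
      (-e * (1 - q * e) * (q / (b * c)))).mul huv
    refine (h1.div (((hqk.comp (tendsto_add_atTop_nat 1)).mul_const e).const_sub 1)
      (by simp)).congr fun N => ?_
    simp only [Pi.div_apply, Function.comp_apply, mul_assoc]
  have := tendsto_nhds_unique hL hR
  simp only [mul_zero, zero_div] at this
  exact sub_eq_zero.1 this

theorem qFactFin_mul_wellPoisedSum {q b c e : ℂ} (hq0 : q ≠ 0) (hq : ‖q‖ < 1) (hb0 : b ≠ 0)
    (hc0 : c ≠ 0) (he0 : e ≠ 0)
    (hb : ∀ i : ℕ, 1 - q ^ (i + 1) / b ≠ 0) (hc : ∀ i : ℕ, 1 - q ^ (i + 1) / c ≠ 0)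
    (he : ∀ i : ℕ, 1 - q ^ (i + 1) * e ≠ 0) (hX : ‖q / (b * c) * e‖ < 1) (N : ℕ) :
    qFactFin (q * e) q N * qFactFin (q / (b * c) * e) q N * wellPoisedSum q b c e =
      qFactFin (q * e / b) q N * qFactFin (q * e / c) q N * wellPoisedSum q b c (q ^ N * e) := by
  induction N with
  | zero => simp [qFactFin_zero]
  | succ N ih =>
    have h := wellPoisedSum_mul_left (e := q ^ N * e) hq hb0 hc0 (by positivity) hb hc
      (fun i => by
        rw [show q ^ (i + 1) * (q ^ N * e) = q ^ (i + N + 1) * e by ring]; exact he _)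
      (by
        rw [show q / (b * c) * (q ^ N * e) = q ^ N * (q / (b * c) * e) by ring, norm_mul, norm_pow]
        exact (mul_le_of_le_one_left (norm_nonneg _)
          (pow_le_one₀ (norm_nonneg q) hq.le)).trans_lt hX)
    simp only [qFactFin_succ]
    rw [show q ^ (N + 1) * e = q * (q ^ N * e) by ring]
    linear_combination (1 - q * e * q ^ N) * (1 - q / (b * c) * e * q ^ N) * ih +
      qFactFin (q * e / b) q N * qFactFin (q * e / c) q N * h

/-- Dominated convergence for series, using the bound uniform in `N`. Each term is continuous at e =
0 because the ratio is written in e = 1/d rather than in d. -/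
theorem tendsto_wellPoisedSum {q b c e : ℂ} (hq : ‖q‖ < 1) (he0 : e ≠ 0)
    (hb : ∀ i : ℕ, 1 - q ^ (i + 1) / b ≠ 0) (hc : ∀ i : ℕ, 1 - q ^ (i + 1) / c ≠ 0)
    (he : ∀ i : ℕ, 1 - q ^ (i + 1) * e ≠ 0) (hX : ‖q / (b * c) * e‖ < 1) :
    Tendsto (fun N : ℕ => wellPoisedSum q b c (q ^ N * e)) atTop (𝓝 (wellPoisedSum q b c 0)) := by
  obtain ⟨C, hC, hC'⟩ := exists_norm_wellPoisedTerm_le hq he0 hb hc he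
  have hqk : Tendsto (fun k : ℕ => q ^ k * e) atTop (𝓝 0) := by
    simpa using (tendsto_pow_atTop_nhds_zero_of_norm_lt_one hq).mul_const e
  refine Tendsto.const_add 1 (tendsto_tsum_of_dominated_convergence
    (bound := fun k => C * ‖q / (b * c) * e‖ ^ (k + 1))
    (((summable_nat_add_iff 1).2 (summable_geometric_of_lt_one (norm_nonneg _) hX)).mul_left C)
    (fun k => ?_) (Eventually.of_forall fun N k => hC' N (k + 1)))
  have hc : ContinuousAt (fun x => wellPoisedTerm q b c x (k + 1)) 0 := by
    unfold wellPoisedTerm wellPoisedRatio qFactFin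
    refine ContinuousAt.mul continuousAt_const (ContinuousAt.div (by fun_prop) (by fun_prop) ?_)
    simp
  exact hc.tendsto.comp hqk

/-- Every term past the leading 1 contains the factor e - q^0, so the series collapses; this fixes
the normalisation. -/
theorem wellPoisedSum_one (q b c : ℂ) : wellPoisedSum q b c 1 = 1 := by
  have h : ∀ k : ℕ, wellPoisedTerm q b c 1 (k + 1) = 0 := fun k => by
    have : ∏ i ∈ Finset.range (k + 1), (1 - q ^ i) = 0 :=
      Finset.prod_eq_zero (i := 0) (by simp) (by simp)
    rw [wellPoisedTerm, wellPoisedRatio, this, zero_div, mul_zero]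
  simp [wellPoisedSum, h]

theorem qFactInf_mul_wellPoisedSum {q b c e : ℂ} (hq0 : q ≠ 0) (hq : ‖q‖ < 1) (hb0 : b ≠ 0)
    (hc0 : c ≠ 0) (he0 : e ≠ 0)
    (hb : ∀ i : ℕ, 1 - q ^ (i + 1) / b ≠ 0) (hc : ∀ i : ℕ, 1 - q ^ (i + 1) / c ≠ 0)
    (he : ∀ i : ℕ, 1 - q ^ (i + 1) * e ≠ 0) (hX : ‖q / (b * c) * e‖ < 1) :
    qFactInf (q * e) q * qFactInf (q / (b * c) * e) q * wellPoisedSum q b c e =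
      qFactInf (q * e / b) q * qFactInf (q * e / c) q * wellPoisedSum q b c 0 := by
  have h1 := ((tendsto_qFactFin (q * e) hq).mul
    (tendsto_qFactFin (q / (b * c) * e) hq)).mul_const (wellPoisedSum q b c e)
  have h2 := ((tendsto_qFactFin (q * e / b) hq).mul
    (tendsto_qFactFin (q * e / c) hq)).mul (tendsto_wellPoisedSum hq he0 hb hc he hX)
  simp only [qFactFin_mul_wellPoisedSum hq0 hq hb0 hc0 he0 hb hc he hX] at h1
  exact tendsto_nhds_unique h1 h2

/-- The nonterminating very-well-poised `₆φ₅` summation with `a = 1`. -/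
theorem wellPoisedSum_eq {q b c e : ℂ} (hq0 : q ≠ 0) (hq : ‖q‖ < 1) (hb0 : b ≠ 0)
    (hc0 : c ≠ 0) (he0 : e ≠ 0)
    (hb : ∀ i : ℕ, 1 - q ^ (i + 1) / b ≠ 0) (hc : ∀ i : ℕ, 1 - q ^ (i + 1) / c ≠ 0)
    (he : ∀ i : ℕ, 1 - q ^ (i + 1) * e ≠ 0) (hX : ‖q / (b * c) * e‖ < 1)
    (hX1 : ‖q / (b * c)‖ < 1) :
    qFactInf (q / b) q * qFactInf (q / c) q *
        (qFactInf (q * e) q * qFactInf (q / (b * c) * e) q) * wellPoisedSum q b c e =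
      qFactInf q q * qFactInf (q / (b * c)) q *
        (qFactInf (q * e / b) q * qFactInf (q * e / c) q) := by
  have h1 := qFactInf_mul_wellPoisedSum hq0 hq hb0 hc0 he0 hb hc he hX
  -- The instance e = 1 determines the unknown value at e = 0, which is then eliminated.
  have h2 := qFactInf_mul_wellPoisedSum (e := 1) hq0 hq hb0 hc0 one_ne_zero hb hc
    (fun i => by
      have := one_sub_mul_pow_ne_zero hq hq i
      rwa [mul_one, pow_succ'])
    (by simpa using hX1)
  simp only [mul_one, wellPoisedSum_one] at h2
  linear_combination qFactInf (q / b) q * qFactInf (q / c) q * h1 -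
    qFactInf (q * e / b) q * qFactInf (q * e / c) q * h2

/-! ### Laurent coefficients on the unit circle -/

/-- The Laurent coefficient of index `j` of a function on the unit circle. -/
def laurentCoeff (h : ℂ → ℂ) (j : ℤ) : ℂ :=
  (2 * Real.pi * Complex.I)⁻¹ * ∮ z in C(0, 1), h z * z ^ (-j - 1)

theorem laurentCoeff_congr {h₁ h₂ : ℂ → ℂ} (h : ∀ z : ℂ, ‖z‖ = 1 → h₁ z = h₂ z) (j : ℤ) :
    laurentCoeff h₁ j = laurentCoeff h₂ j := by
  unfold laurentCoeff
  congr 1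
  refine circleIntegral.integral_congr zero_le_one fun z hz => ?_
  simp only [h z (by simpa using hz)]

theorem ne_zero_of_norm_eq_one {z : ℂ} (hz : ‖z‖ = 1) : z ≠ 0 := by
  rintro rfl; simp at hz

theorem continuousOn_zpow_sphere (m : ℤ) :
    ContinuousOn (fun z : ℂ => z ^ m) (Metric.sphere 0 1) :=
  continuousOn_id.zpow₀ m fun z hz => Or.inl (ne_zero_of_norm_eq_one (by simpa using hz))

theorem circleIntegrable_mul_zpow {h : ℂ → ℂ} (hh : ContinuousOn h (Metric.sphere 0 1)) (m : ℤ) :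
    CircleIntegrable (fun z => h z * z ^ m) 0 1 :=
  ContinuousOn.circleIntegrable zero_le_one (hh.mul (continuousOn_zpow_sphere m))

theorem laurentCoeff_sub {h₁ h₂ : ℂ → ℂ} (hh₁ : ContinuousOn h₁ (Metric.sphere 0 1))
    (hh₂ : ContinuousOn h₂ (Metric.sphere 0 1)) (j : ℤ) :
    laurentCoeff (fun z => h₁ z - h₂ z) j = laurentCoeff h₁ j - laurentCoeff h₂ j := by
  simp only [laurentCoeff, sub_mul]
  rw [circleIntegral.integral_sub (circleIntegrable_mul_zpow hh₁ _)
    (circleIntegrable_mul_zpow hh₂ _), mul_sub]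

theorem laurentCoeff_const_mul (a : ℂ) (h : ℂ → ℂ) (j : ℤ) :
    laurentCoeff (fun z => a * h z) j = a * laurentCoeff h j := by
  simp only [laurentCoeff, mul_assoc, circleIntegral.integral_const_mul]
  ring

theorem laurentCoeff_id_mul (h : ℂ → ℂ) (j : ℤ) :
    laurentCoeff (fun z => z * h z) j = laurentCoeff h (j - 1) := by
  unfold laurentCoeff
  congr 1
  refine circleIntegral.integral_congr zero_le_one fun z hz => ?_
  have hz0 : z ≠ 0 := ne_zero_of_norm_eq_one (by simpa using hz)
  simp only
  rw [show -(j - 1) - 1 = (-j - 1) + 1 by ring, zpow_add_one₀ hz0]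
  ring

theorem laurentCoeff_inv_mul (h : ℂ → ℂ) (j : ℤ) :
    laurentCoeff (fun z => z⁻¹ * h z) j = laurentCoeff h (j + 1) := by
  unfold laurentCoeff
  congr 1
  refine circleIntegral.integral_congr zero_le_one fun z hz => ?_
  have hz0 : z ≠ 0 := ne_zero_of_norm_eq_one (by simpa using hz)
  simp only
  rw [show -(j + 1) - 1 = (-j - 1) - 1 by ring, zpow_sub_one₀ hz0 (-j - 1)]
  ring

theorem laurentCoeff_eq_integral (h : ℂ → ℂ) (j : ℤ) :
    laurentCoeff h j = (2 * Real.pi : ℂ)⁻¹ *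
      ∫ θ in 0..2 * Real.pi, h (circleMap 0 1 θ) * circleMap 0 1 θ ^ (-j) := by
  have h1 : (∮ z in C(0, 1), h z * z ^ (-j - 1)) = Complex.I *
      ∫ θ in 0..2 * Real.pi, h (circleMap 0 1 θ) * circleMap 0 1 θ ^ (-j) := by
    rw [circleIntegral, ← intervalIntegral.integral_const_mul]
    refine intervalIntegral.integral_congr fun θ _ => ?_
    have h0 : circleMap 0 1 θ ≠ 0 := circleMap_ne_center one_ne_zero
    simp only [deriv_circleMap, smul_eq_mul]
    rw [zpow_sub_one₀ h0]
    field_simp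
  rw [laurentCoeff, h1, ← mul_assoc]
  congr 1
  field_simp

/-- On the unit circle inversion is the reflection θ ↦ 2π - θ. -/
theorem laurentCoeff_neg (h : ℂ → ℂ) (j : ℤ) :
    laurentCoeff h (-j) = laurentCoeff (fun z => h z⁻¹) j := by
  rw [laurentCoeff_eq_integral, laurentCoeff_eq_integral]
  congr 1
  have h1 : ∀ θ : ℝ, circleMap 0 1 (2 * Real.pi - θ) = (circleMap 0 1 θ)⁻¹ := fun θ => by
    rw [circleMap_zero_inv, inv_one, sub_eq_neg_add, periodic_circleMap 0 1 (-θ)]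
  have h2 := intervalIntegral.integral_comp_sub_left (a := 0) (b := 2 * Real.pi)
    (fun θ => h (circleMap 0 1 θ) * circleMap 0 1 θ ^ (- -j)) (2 * Real.pi)
  rw [sub_self, sub_zero] at h2
  rw [← h2]
  simp only [h1, inv_zpow', neg_neg]

/-- Multiplication by `q` rescales the radius to ‖q‖ and rotates by arg q; periodicity absorbs the
rotation. -/
theorem circleIntegral_comp_mul_left {q : ℂ} (hq : q ≠ 0) (F : ℂ → ℂ) :
    (∮ z in C(0, 1), F (q * z)) = q⁻¹ * ∮ z in C(0, ‖q‖), F z := by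
  have key : ∀ θ : ℝ, q * circleMap 0 1 θ = circleMap 0 ‖q‖ (θ + q.arg) := fun θ => by
    conv_lhs => rw [← Complex.norm_mul_exp_arg_mul_I q]
    simp only [circleMap, zero_add, Complex.ofReal_one, one_mul, Complex.ofReal_add, add_mul,
      Complex.exp_add]
    ring
  set G : ℝ → ℂ := fun θ => deriv (circleMap 0 ‖q‖) θ • F (circleMap 0 ‖q‖ θ) with hG
  have hper : Function.Periodic G (2 * Real.pi) := fun θ => by
    simp only [hG, deriv_circleMap, periodic_circleMap 0 ‖q‖ θ]
  have h1 : (∮ z in C(0, 1), F (q * z)) = q⁻¹ * ∫ θ in 0..2 * Real.pi, G (θ + q.arg) := by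
    rw [circleIntegral, ← intervalIntegral.integral_const_mul]
    refine intervalIntegral.integral_congr fun θ _ => ?_
    simp only [hG, deriv_circleMap, smul_eq_mul]
    rw [← key θ]
    field_simp
  rw [h1, intervalIntegral.integral_comp_add_right, zero_add, add_comm,
    hper.intervalIntegral_add_eq q.arg 0, zero_add]
  rfl

/-- The Laurent coefficients of a dilated function that is holomorphic on the annulus swept by
the dilation. -/
theorem laurentCoeff_comp_mul_left {q : ℂ} (hq0 : q ≠ 0) (hq : ‖q‖ < 1) {g : ℂ → ℂ}
    (hg : ∀ z : ℂ, ‖q‖ ≤ ‖z‖ → ‖z‖ ≤ 1 → DifferentiableAt ℂ g z) (j : ℤ) :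
    laurentCoeff (fun z => g (q * z)) j = q ^ j * laurentCoeff g j := by
  have hqn : 0 < ‖q‖ := norm_pos_iff.2 hq0
  have hd : ∀ z : ℂ, ‖q‖ ≤ ‖z‖ → ‖z‖ ≤ 1 →
      DifferentiableAt ℂ (fun z => g z * z ^ (-j - 1)) z := fun z h1 h2 =>
    (hg z h1 h2).mul (differentiableAt_zpow.2 (Or.inl (norm_pos_iff.1 (hqn.trans_le h1))))
  have h1 := circleIntegral_comp_mul_left hq0 fun z => g z * z ^ (-j - 1)
  -- Cauchy's theorem on the annulus moves the circle of radius ‖q‖ back to the unit circle.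
  rw [← Complex.circleIntegral_eq_of_differentiable_on_annulus_off_countable hqn hq.le
    (s := ∅) Set.countable_empty (f := fun z => g z * z ^ (-j - 1))
    (fun z hz => ?_) (fun z hz => ?_)] at h1
  · unfold laurentCoeff
    rw [mul_left_comm, ← sub_eq_zero, ← mul_sub]
    convert mul_zero _
    rw [sub_eq_zero]
    calc (∮ z in C(0, 1), g (q * z) * z ^ (-j - 1))
        = ∮ z in C(0, 1), q ^ (j + 1) * (g (q * z) * (q * z) ^ (-j - 1)) := by
          refine circleIntegral.integral_congr zero_le_one fun z hz => ?_
          rw [mul_zpow, show -j - 1 = -(j + 1) by ring, zpow_neg q]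
          have := zpow_ne_zero (j + 1) hq0
          field_simp
      _ = q ^ j * ∮ z in C(0, 1), g z * z ^ (-j - 1) := by
          rw [circleIntegral.integral_const_mul, h1, zpow_add_one₀ hq0]
          field_simp
  · simp only [Set.mem_sdiff, Metric.mem_closedBall, dist_zero_right, Metric.mem_ball,
      not_lt] at hz
    exact (hd z hz.2 hz.1).continuousAt.continuousWithinAt
  · simp only [Set.mem_sdiff, Metric.mem_closedBall, dist_zero_right, Metric.mem_ball,
      not_le, Set.mem_empty_iff_false, not_false_eq_true, and_true] at hz
    exact hd z hz.2.le hz.1.le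

/-! ### Laurent coefficients of the weight, via a theta-type kernel -/

/-- The continuous `q`-ultraspherical weight as a function of `z = e^{2iθ}`. -/
def ultraWeight (q β z : ℂ) : ℂ :=
  qFactInf z q * qFactInf z⁻¹ q / (qFactInf (β * z) q * qFactInf (β * z⁻¹) q)

/-- The bilateral theta-type kernel `(z, q/z;q)_∞ / (βz, β/z;q)_∞`. -/
def ultraKernel (q β z : ℂ) : ℂ :=
  qFactInf z q * qFactInf (q * z⁻¹) q / (qFactInf (β * z) q * qFactInf (β * z⁻¹) q)

theorem qFactInf_mul_ne_zero {q β z : ℂ} (hq : ‖q‖ < 1) (hβ : ‖β‖ < 1) (hz : ‖z‖ ≤ 1) :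
    qFactInf (β * z) q ≠ 0 :=
  qFactInf_ne_zero_of_norm_lt_one hq (by
    rw [norm_mul]
    exact (mul_le_of_le_one_right (norm_nonneg β) hz).trans_lt hβ)

theorem continuousOn_inv_sphere : ContinuousOn (fun z : ℂ => z⁻¹) (Metric.sphere 0 1) :=
  continuousOn_inv₀.mono fun z hz => ne_zero_of_norm_eq_one (by simpa using hz)

theorem continuousOn_qFactInf_comp {q : ℂ} (hq : ‖q‖ < 1) {F : ℂ → ℂ} {s : Set ℂ}
    (hF : ContinuousOn F s) : ContinuousOn (fun z => qFactInf (F z) q) s :=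
  (continuous_qFactInf hq).comp_continuousOn hF

theorem qFactInf_mul_ne_zero_of_norm_eq_one {q β z : ℂ} (hq : ‖q‖ < 1) (hβ : ‖β‖ < 1)
    (hz : ‖z‖ = 1) : qFactInf (β * z) q ≠ 0 ∧ qFactInf (β * z⁻¹) q ≠ 0 :=
  ⟨qFactInf_mul_ne_zero hq hβ hz.le, qFactInf_mul_ne_zero hq hβ (by simp [hz])⟩

theorem continuousOn_ultraKernel {q β : ℂ} (hq : ‖q‖ < 1) (hβ : ‖β‖ < 1) :
    ContinuousOn (ultraKernel q β) (Metric.sphere 0 1) := by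
  refine ContinuousOn.div
    ((continuousOn_qFactInf_comp hq continuousOn_id).mul
      (continuousOn_qFactInf_comp hq (continuousOn_inv_sphere.const_mul q)))
    ((continuousOn_qFactInf_comp hq (continuousOn_id.const_mul β)).mul
      (continuousOn_qFactInf_comp hq (continuousOn_inv_sphere.const_mul β))) fun z hz => ?_
  have := qFactInf_mul_ne_zero_of_norm_eq_one hq hβ (z := z) (by simpa using hz)
  exact mul_ne_zero this.1 this.2

theorem continuousOn_ultraWeight {q β : ℂ} (hq : ‖q‖ < 1) (hβ : ‖β‖ < 1) :
    ContinuousOn (ultraWeight q β) (Metric.sphere 0 1) := by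
  refine ContinuousOn.div
    ((continuousOn_qFactInf_comp hq continuousOn_id).mul
      (continuousOn_qFactInf_comp hq continuousOn_inv_sphere))
    ((continuousOn_qFactInf_comp hq (continuousOn_id.const_mul β)).mul
      (continuousOn_qFactInf_comp hq (continuousOn_inv_sphere.const_mul β))) fun z hz => ?_
  have := qFactInf_mul_ne_zero_of_norm_eq_one hq hβ (z := z) (by simpa using hz)
  exact mul_ne_zero this.1 this.2

theorem ultraWeight_inv (q β z : ℂ) : ultraWeight q β z⁻¹ = ultraWeight q β z := by
  simp only [ultraWeight, inv_inv]
  ring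

/-- Splitting off the first factor of (1/z;q)_∞ gives w = (1 - 1/z)K. The kernel has the simpler
dilation behaviour: passing from z to qz exchanges a factor 1 - z for 1 - 1/z, and their quotient is
just -1/z. -/
theorem ultraWeight_eq {q : ℂ} (hq : ‖q‖ < 1) (β z : ℂ) :
    ultraWeight q β z = ultraKernel q β z - z⁻¹ * ultraKernel q β z := by
  rw [ultraWeight, qFactInf_eq_one_sub_mul z⁻¹ hq, ultraKernel, mul_comm z⁻¹ q]
  ring

theorem laurentCoeff_ultraWeight {q β : ℂ} (hq : ‖q‖ < 1) (hβ : ‖β‖ < 1) (j : ℤ) :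
    laurentCoeff (ultraWeight q β) j =
      laurentCoeff (ultraKernel q β) j - laurentCoeff (ultraKernel q β) (j + 1) := by
  have hc := continuousOn_ultraKernel hq hβ
  have hci : ContinuousOn (fun z => z⁻¹ * ultraKernel q β z) (Metric.sphere 0 1) :=
    continuousOn_inv_sphere.mul hc
  rw [← laurentCoeff_inv_mul, ← laurentCoeff_sub hc hci]
  exact laurentCoeff_congr (fun z _ => ultraWeight_eq hq β z) j

theorem laurentCoeff_ultraWeight_neg (q β : ℂ) (j : ℤ) :
    laurentCoeff (ultraWeight q β) (-j) = laurentCoeff (ultraWeight q β) j := by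
  rw [laurentCoeff_neg]
  exact laurentCoeff_congr (fun z _ => ultraWeight_inv q β z) j

/-- Contour shift applied to g = (1 - β/z)K, for which g(qz) = (β - 1/z)K(z). The coefficients of
g(qz) are q^j times those of g, which is the recurrence. The factor 1 - β/z removes the possible
pole of K at z = β, so that g is holomorphic on ‖q‖ ≤ ‖z‖ ≤ 1. -/
theorem laurentCoeff_ultraKernel_succ {q β : ℂ} (hq0 : q ≠ 0) (hq : ‖q‖ < 1) (hβ : ‖β‖ < 1)
    (j : ℤ) :
    laurentCoeff (ultraKernel q β) (j + 1) * (1 - β * q ^ j) =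
      laurentCoeff (ultraKernel q β) j * (β - q ^ j) := by
  have hc := continuousOn_ultraKernel hq hβ
  have hci : ContinuousOn (fun z => z⁻¹ * ultraKernel q β z) (Metric.sphere 0 1) :=
    continuousOn_inv_sphere.mul hc
  set g : ℂ → ℂ := fun z =>
    qFactInf z q * qFactInf (q * z⁻¹) q / (qFactInf (β * z) q * qFactInf (q * β * z⁻¹) q) with hg
  have h1 : laurentCoeff g j =
      laurentCoeff (ultraKernel q β) j - β * laurentCoeff (ultraKernel q β) (j + 1) := by
    rw [← laurentCoeff_inv_mul, ← laurentCoeff_const_mul,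
      ← laurentCoeff_sub hc (h₂ := fun z => β * (z⁻¹ * ultraKernel q β z)) (hci.const_mul β)]
    refine laurentCoeff_congr (fun z hz => ?_) j
    obtain ⟨n1, n2⟩ := qFactInf_mul_ne_zero_of_norm_eq_one hq hβ hz
    simp only [hg, ultraKernel]
    rw [qFactInf_eq_one_sub_mul (β * z⁻¹) hq] at n2 ⊢
    rw [show q * β * z⁻¹ = β * z⁻¹ * q by ring]
    have n3 := left_ne_zero_of_mul n2
    have n4 := right_ne_zero_of_mul n2
    generalize hD : 1 - β * z⁻¹ = D at *
    generalize qFactInf (β * z⁻¹ * q) q = E at *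
    have : ∀ x : ℂ, x - β * (z⁻¹ * x) = D * x := fun x => by rw [← hD]; ring
    rw [this]
    field_simp
  have h2 : laurentCoeff (fun z => g (q * z)) j =
      β * laurentCoeff (ultraKernel q β) j - laurentCoeff (ultraKernel q β) (j + 1) := by
    rw [← laurentCoeff_inv_mul, ← laurentCoeff_const_mul,
      ← laurentCoeff_sub (hc.const_mul β) hci]
    refine laurentCoeff_congr (fun z hz => ?_) j
    obtain ⟨n1, n2⟩ := qFactInf_mul_ne_zero_of_norm_eq_one hq hβ hz
    have hz0 := ne_zero_of_norm_eq_one hz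
    simp only [hg, ultraKernel]
    rw [show q * (q * z)⁻¹ = z⁻¹ by field_simp, show q * β * (q * z)⁻¹ = β * z⁻¹ by field_simp,
      qFactInf_eq_one_sub_mul z⁻¹ hq, qFactInf_eq_one_sub_mul z hq,
      show z⁻¹ * q = q * z⁻¹ by ring, show z * q = q * z by ring]
    rw [qFactInf_eq_one_sub_mul (β * z) hq, show β * z * q = β * (q * z) by ring] at n1 ⊢
    have n3 := left_ne_zero_of_mul n1
    have n4 := right_ne_zero_of_mul n1
    generalize qFactInf (β * (q * z)) q = E at *
    generalize qFactInf (β * z⁻¹) q = F at *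
    generalize qFactInf (q * z⁻¹) q = G at *
    generalize qFactInf (q * z) q = H at *
    generalize hD : 1 - β * z = D at *
    field_simp
    rw [← hD]
    ring
  have h3 := laurentCoeff_comp_mul_left hq0 hq (g := g) (fun z hz1 hz2 => by
    have hqn : 0 < ‖q‖ := norm_pos_iff.2 hq0
    have hz0 : z ≠ 0 := norm_pos_iff.1 (hqn.trans_le hz1)
    have d := differentiable_qFactInf hq
    have di : DifferentiableAt ℂ (fun z : ℂ => z⁻¹) z := differentiableAt_inv hz0
    refine DifferentiableAt.div
      ((d z).mul ((d _).comp z (di.const_mul q)))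
      (((d _).comp z (differentiableAt_id.const_mul β)).mul
        ((d _).comp z (di.const_mul (q * β)))) (mul_ne_zero ?_ ?_)
    · exact qFactInf_mul_ne_zero hq hβ hz2
    · rw [show q * β * z⁻¹ = β * (q * z⁻¹) by ring]
      refine qFactInf_mul_ne_zero hq hβ ?_
      rw [norm_mul, norm_inv, ← div_eq_mul_inv]
      exact div_le_one_of_le₀ hz1 (norm_nonneg z)) j
  rw [h1, h2] at h3
  linear_combination -h3

/-- Replacing β by qβ multiplies K by (1 - βz)(1 - β/z), so the new constant term involves K_{-1},
K_0, K_1 only. The recurrence at j = 0 and j = -1 reduces these to K_0. -/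
theorem laurentCoeff_ultraKernel_zero_mul_left {q β : ℂ} (hq0 : q ≠ 0) (hq : ‖q‖ < 1)
    (hβ : ‖β‖ < 1) :
    laurentCoeff (ultraKernel q (q * β)) 0 * (1 - β * q) =
      laurentCoeff (ultraKernel q β) 0 * ((1 + β) * (1 - q * β ^ 2)) := by
  have hc := continuousOn_ultraKernel hq hβ
  have hci : ContinuousOn (fun z => z⁻¹ * ultraKernel q β z) (Metric.sphere 0 1) :=
    continuousOn_inv_sphere.mul hc
  have hcz : ContinuousOn (fun z => z * ultraKernel q β z) (Metric.sphere 0 1) :=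
    continuousOn_id.mul hc
  have h1 : laurentCoeff (ultraKernel q (q * β)) 0 =
      (1 + β ^ 2) * laurentCoeff (ultraKernel q β) 0 - β * laurentCoeff (ultraKernel q β) (0 - 1) -
        β * laurentCoeff (ultraKernel q β) (0 + 1) := by
    rw [← laurentCoeff_inv_mul, ← laurentCoeff_id_mul, ← laurentCoeff_const_mul,
      ← laurentCoeff_const_mul, ← laurentCoeff_const_mul,
      ← laurentCoeff_sub (hc.const_mul _) (hcz.const_mul β),
      ← laurentCoeff_sub
        (h₁ := fun z => (1 + β ^ 2) * ultraKernel q β z - β * (z * ultraKernel q β z))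
        ((hc.const_mul _).sub (hcz.const_mul β)) (hci.const_mul β)]
    refine laurentCoeff_congr (fun z hz => ?_) 0
    obtain ⟨n1, n2⟩ := qFactInf_mul_ne_zero_of_norm_eq_one hq hβ hz
    have hz0 := ne_zero_of_norm_eq_one hz
    simp only [ultraKernel]
    rw [qFactInf_eq_one_sub_mul (β * z) hq, show β * z * q = q * β * z by ring] at n1 ⊢
    rw [qFactInf_eq_one_sub_mul (β * z⁻¹) hq, show β * z⁻¹ * q = q * β * z⁻¹ by ring] at n2 ⊢
    have n3 := left_ne_zero_of_mul n1
    have n4 := right_ne_zero_of_mul n1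
    have n5 := left_ne_zero_of_mul n2
    have n6 := right_ne_zero_of_mul n2
    have key : ∀ x : ℂ, (1 + β ^ 2) * x - β * (z * x) - β * (z⁻¹ * x) =
        (1 - β * z) * (1 - β * z⁻¹) * x := fun x => by
      linear_combination (-(β ^ 2) * x) * (mul_inv_cancel₀ hz0)
    rw [key]
    generalize 1 - β * z = D at *
    generalize 1 - β * z⁻¹ = D' at *
    field_simp
  have h2 := laurentCoeff_ultraKernel_succ hq0 hq hβ 0
  have h3 := laurentCoeff_ultraKernel_succ hq0 hq hβ (-1)
  have hb : 1 - β ≠ 0 := by simpa using one_sub_mul_pow_ne_zero hq hβ 0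
  have h2' : laurentCoeff (ultraKernel q β) (0 + 1) = -laurentCoeff (ultraKernel q β) 0 := by
    refine mul_right_cancel₀ hb ?_
    rw [zpow_zero] at h2
    linear_combination h2
  rw [neg_add_cancel, zpow_neg_one] at h3
  rw [h1, h2', zero_sub]
  have hqq := mul_inv_cancel₀ hq0
  linear_combination (-(q * β)) * h3 - (laurentCoeff (ultraKernel q β) 0 * β ^ 2 -
    β * laurentCoeff (ultraKernel q β) (-1)) * hqq

/-- Dominated convergence on the circle: the reciprocals of the denominator factors are bounded by
compactness of the disc of radius ‖β‖, on which (·;q)_∞ has no zero. -/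
theorem tendsto_laurentCoeff_ultraKernel {q β : ℂ} (hq : ‖q‖ < 1) (hβ : ‖β‖ < 1) :
    Tendsto (fun N : ℕ => laurentCoeff (ultraKernel q (q ^ N * β)) 0) atTop
      (𝓝 (laurentCoeff (ultraKernel q 0) 0)) := by
  have hle : ∀ N : ℕ, ‖q ^ N * β‖ ≤ ‖β‖ := fun N => by
    rw [norm_mul, norm_pow]
    exact mul_le_of_le_one_left (norm_nonneg β) (pow_le_one₀ (norm_nonneg q) hq.le)
  have hball : ∀ x ∈ Metric.closedBall (0 : ℂ) ‖β‖, qFactInf x q ≠ 0 := fun x hx =>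
    qFactInf_ne_zero_of_norm_lt_one hq ((show ‖x‖ ≤ ‖β‖ by simpa using hx).trans_lt hβ)
  obtain ⟨B, hB⟩ := (isCompact_closedBall (0 : ℂ) ‖β‖).exists_bound_of_continuousOn
    ((continuous_qFactInf hq).continuousOn.inv₀ hball)
  have hqN : Tendsto (fun N : ℕ => q ^ N * β) atTop (𝓝 0) := by
    simpa using (tendsto_pow_atTop_nhds_zero_of_norm_lt_one hq).mul_const β
  have hcont : ∀ γ : ℂ, ‖γ‖ < 1 → Continuous fun θ : ℝ =>
      ultraKernel q γ (circleMap 0 1 θ) * circleMap 0 1 θ ^ (-0 : ℤ) := fun γ hγ => by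
    simp only [neg_zero, zpow_zero, mul_one]
    exact (continuousOn_ultraKernel hq hγ).comp_continuous (continuous_circleMap 0 1)
      fun θ => circleMap_mem_sphere 0 zero_le_one θ
  simp only [laurentCoeff_eq_integral]
  refine Tendsto.const_mul _ (intervalIntegral.tendsto_integral_filter_of_dominated_convergence
    (fun θ => ‖qFactInf (circleMap 0 1 θ) q * qFactInf (q * (circleMap 0 1 θ)⁻¹) q‖ * (B * B))
    (Eventually.of_forall fun N => (hcont _ ((hle N).trans_lt hβ)).aestronglyMeasurable)
    (Eventually.of_forall fun N => Eventually.of_forall fun θ _ => ?_) ?_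
    (Eventually.of_forall fun θ _ => ?_))
  · have hz : ‖circleMap 0 1 θ‖ = 1 := by simp
    have hb : ∀ z : ℂ, ‖z‖ = 1 → ‖(qFactInf (q ^ N * β * z) q)⁻¹‖ ≤ B := fun z hz =>
      hB _ (by simpa [hz] using hle N)
    rw [neg_zero, zpow_zero, mul_one, ultraKernel, div_eq_mul_inv, mul_inv, norm_mul, norm_mul _ _⁻¹]
    gcongr
    · exact (norm_nonneg _).trans (hb _ hz)
    · exact hb _ hz
    · exact hb _ (by simp [hz])
  · refine Continuous.intervalIntegrable ?_ _ _
    have h1 : Continuous fun θ : ℝ => (circleMap 0 1 θ)⁻¹ :=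
      (continuous_circleMap 0 1).inv₀ fun θ => circleMap_ne_center one_ne_zero
    exact ((((continuous_qFactInf hq).comp (continuous_circleMap 0 1)).mul
      ((continuous_qFactInf hq).comp (h1.const_mul q))).norm).mul_const _
  · refine Tendsto.mul_const _ ?_
    have hc : ContinuousAt (fun γ => ultraKernel q γ (circleMap 0 1 θ)) 0 := by
      have d := continuous_qFactInf hq
      refine ContinuousAt.div continuousAt_const (ContinuousAt.mul ?_ ?_)
        (by simp [qFactInf_zero_left])
      · exact (d.comp (continuous_mul_const _)).continuousAt
      · exact (d.comp (continuous_mul_const _)).continuousAt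
    exact hc.tendsto.comp hqN

theorem laurentCoeff_one_sub_id : laurentCoeff (fun z => 1 - z) 0 = 1 := by
  have h1 : laurentCoeff (fun _ => 1) 0 = 1 := by
    have hp : (Real.pi : ℂ) ≠ 0 := Complex.ofReal_ne_zero.2 Real.pi_ne_zero
    rw [laurentCoeff_eq_integral]
    simp
    field_simp
  have h2 : laurentCoeff (fun _ => 1) (0 - 1) = 0 := by
    rw [laurentCoeff]
    have := circleIntegral.integral_sub_zpow_of_ne (n := 0) (by norm_num) 0 0 1
    simp only [zpow_zero] at this
    simp [this]
  rw [laurentCoeff_sub continuousOn_const (continuousOn_id' _), h1]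
  have := laurentCoeff_id_mul (fun _ => 1) 0
  simp only [mul_one] at this
  rw [this, h2, sub_zero]

/-- For β = q all factors cancel except 1 - z. -/
theorem laurentCoeff_ultraKernel_self {q : ℂ} (hq : ‖q‖ < 1) :
    laurentCoeff (ultraKernel q q) 0 = 1 := by
  rw [← laurentCoeff_one_sub_id]
  refine laurentCoeff_congr (fun z hz => ?_) 0
  obtain ⟨n1, n2⟩ := qFactInf_mul_ne_zero_of_norm_eq_one hq hq hz
  rw [ultraKernel, qFactInf_eq_one_sub_mul z hq, mul_comm z q, mul_div_mul_right _ _ n2,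
    mul_div_cancel_right₀ _ n1]

/-- The normalised constant term of `ultraKernel` is invariant under `β ↦ qβ`. -/
theorem laurentCoeff_ultraKernel_zero_eq_limit {q β : ℂ} (hq0 : q ≠ 0) (hq : ‖q‖ < 1)
    (hβ : ‖β‖ < 1) :
    laurentCoeff (ultraKernel q β) 0 * qFactInf (β ^ 2) q / (qFactInf β q * qFactInf (q * β) q) =
      laurentCoeff (ultraKernel q 0) 0 := by
  set R : ℂ → ℂ := fun β => laurentCoeff (ultraKernel q β) 0 * qFactInf (β ^ 2) q /
    (qFactInf β q * qFactInf (q * β) q) with hR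
  have hle : ∀ N : ℕ, ‖q ^ N * β‖ < 1 := fun N => by
    rw [norm_mul, norm_pow]
    exact (mul_le_of_le_one_left (norm_nonneg β) (pow_le_one₀ (norm_nonneg q) hq.le)).trans_lt hβ
  have hstep : ∀ γ : ℂ, ‖γ‖ < 1 → R (q * γ) = R γ := fun γ hγ => by
    have hqγ : ‖q * γ‖ < 1 := by
      rw [norm_mul]; exact (mul_le_of_le_one_left (norm_nonneg γ) hq.le).trans_lt hγ
    have hqqγ : ‖q * (q * γ)‖ < 1 := by
      rw [norm_mul]; exact (mul_le_of_le_one_left (norm_nonneg _) hq.le).trans_lt hqγ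
    have h := laurentCoeff_ultraKernel_zero_mul_left hq0 hq hγ
    have n1 := qFactInf_ne_zero_of_norm_lt_one hq hqγ
    have n2 := qFactInf_ne_zero_of_norm_lt_one hq hqqγ
    have n3 : 1 - γ ≠ 0 := by simpa using one_sub_mul_pow_ne_zero hq hγ 0
    have n4 : 1 - q * γ ≠ 0 := by simpa using one_sub_mul_pow_ne_zero hq hqγ 0
    simp only [hR]
    rw [qFactInf_eq_one_sub_mul (γ ^ 2) hq, qFactInf_eq_one_sub_mul (γ ^ 2 * q) hq,
      qFactInf_eq_one_sub_mul γ hq, mul_comm γ q,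
      show qFactInf (q * γ) q = (1 - q * γ) * qFactInf (q * (q * γ)) q by
        rw [qFactInf_eq_one_sub_mul (q * γ) hq, mul_comm (q * γ) q],
      show γ ^ 2 * q * q = (q * γ) ^ 2 by ring]
    rw [div_eq_div_iff (by positivity) (by positivity)]
    linear_combination ((1 - γ) * (1 - q * γ) * qFactInf (q * (q * γ)) q ^ 2 *
      qFactInf ((q * γ) ^ 2) q) * h
  have hconst : ∀ N : ℕ, R (q ^ N * β) = R β := fun N => by
    induction N with
    | zero => simp
    | succ N ih => rw [← ih, ← hstep _ (hle N), pow_succ', mul_assoc]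
  have hqN : Tendsto (fun N : ℕ => q ^ N * β) atTop (𝓝 0) := by
    simpa using (tendsto_pow_atTop_nhds_zero_of_norm_lt_one hq).mul_const β
  have d := continuous_qFactInf hq
  have h1 : ContinuousAt (fun γ => qFactInf (γ ^ 2) q) 0 := (d.comp (continuous_pow 2)).continuousAt
  have h2 : ContinuousAt (fun γ => qFactInf γ q * qFactInf (q * γ) q) 0 :=
    (d.mul (d.comp (continuous_const_mul q))).continuousAt
  have hlim : Tendsto (fun N : ℕ => R (q ^ N * β)) atTop
      (𝓝 (laurentCoeff (ultraKernel q 0) 0 * qFactInf (0 ^ 2) q /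
        (qFactInf 0 q * qFactInf (q * 0) q))) :=
    ((tendsto_laurentCoeff_ultraKernel hq hβ).mul (h1.tendsto.comp hqN)).div
      (h2.tendsto.comp hqN) (by simp [qFactInf_zero_left])
  simp only [hconst] at hlim
  have := tendsto_nhds_unique tendsto_const_nhds hlim
  simpa [qFactInf_zero_left] using this

/-- The constant term of `ultraKernel`, a case of Ramanujan's `₁ψ₁` summation. -/
theorem laurentCoeff_ultraKernel_zero {q β : ℂ} (hq0 : q ≠ 0) (hq : ‖q‖ < 1) (hβ : ‖β‖ < 1) :
    laurentCoeff (ultraKernel q β) 0 =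
      qFactInf β q * qFactInf (q * β) q / (qFactInf q q * qFactInf (β ^ 2) q) := by
  have h1 := laurentCoeff_ultraKernel_zero_eq_limit hq0 hq hβ
  -- The limit does not depend on β, so the explicit case β = q evaluates it.
  have h2 := laurentCoeff_ultraKernel_zero_eq_limit hq0 hq hq
  rw [← h2, laurentCoeff_ultraKernel_self hq, sq q] at h1
  have hlt : ∀ x y : ℂ, ‖x‖ < 1 → ‖y‖ < 1 → ‖x * y‖ < 1 := fun x y hx hy => by
    rw [norm_mul]; exact (mul_le_of_le_one_left (norm_nonneg _) hx.le).trans_lt hy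
  have n1 := qFactInf_ne_zero_of_norm_lt_one hq hβ
  have n2 := qFactInf_ne_zero_of_norm_lt_one hq (hlt q β hq hβ)
  have n3 := qFactInf_ne_zero_of_norm_lt_one hq (hlt q q hq hq)
  have n4 := qFactInf_ne_zero_of_norm_lt_one hq hq
  have n5 : qFactInf (β ^ 2) q ≠ 0 := by
    rw [sq]; exact qFactInf_ne_zero_of_norm_lt_one hq (hlt β β hβ hβ)
  rw [one_mul, mul_comm (qFactInf q q), div_mul_cancel_left₀ n3, div_eq_iff (mul_ne_zero n1 n2)] at h1
  rw [eq_div_iff (mul_ne_zero n4 n5)]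
  linear_combination qFactInf q q * h1 +
    qFactInf β q * qFactInf (q * β) q * (mul_inv_cancel₀ n4)

/-- One more use of the recurrence turns K_j - K_{j+1} into K_j(1 - β)(1 + q^j)/(1 - βq^j). The
factor 1 + q^j is the very-well-poised one, and (1 - β)/(1 - βq^j) accounts for the shift of the
denominators from q^i to q^{i+1}. -/
theorem laurentCoeff_ultraWeight_natCast {q β : ℂ} (hq0 : q ≠ 0) (hq : ‖q‖ < 1) (hβ : ‖β‖ < 1)
    (j : ℕ) :
    laurentCoeff (ultraWeight q β) j = laurentCoeff (ultraKernel q β) 0 * (1 + q ^ j) *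
      ∏ i ∈ Finset.range j, ((β - q ^ i) / (1 - β * q ^ (i + 1))) := by
  have hn := one_sub_mul_pow_ne_zero hq hβ
  have h1 : ∀ j : ℕ, laurentCoeff (ultraKernel q β) j * (1 - β) =
      (1 - β * q ^ j) * (laurentCoeff (ultraKernel q β) 0 *
        ∏ i ∈ Finset.range j, ((β - q ^ i) / (1 - β * q ^ (i + 1)))) := fun j => by
    induction j with
    | zero => simp [mul_comm]
    | succ j ih =>
      have h := laurentCoeff_ultraKernel_succ hq0 hq hβ j
      rw [zpow_natCast] at h
      have hj := hn j
      have hj1 := hn (j + 1)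
      refine mul_right_cancel₀ hj ?_
      rw [Finset.prod_range_succ]
      push_cast
      rw [mul_right_comm, h, mul_right_comm, ih]
      field_simp
  have hb : 1 - β ≠ 0 := by simpa using hn 0
  have hj := hn j
  refine mul_right_cancel₀ (mul_ne_zero hb hj) ?_
  have h := laurentCoeff_ultraKernel_succ hq0 hq hβ j
  rw [zpow_natCast] at h
  rw [laurentCoeff_ultraWeight hq hβ]
  linear_combination (1 - β) * (1 + q ^ j) * h1 j - (1 - β) * h

/-! ### The coefficients of the bilateral series: non-vanishing, reflection, decay -/

/-- If β = q^m then m ≥ 1 because ‖β‖ < 1, whence ‖β‖² ≤ ‖β‖ ≤ ‖q‖, a contradiction. This keeps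
every factor 1 - βq^m and 1 - q^m/β away from zero. -/
theorem zpow_ne_of_norm_lt_sq {q β : ℂ} (hq0 : q ≠ 0) (hqβ : ‖q‖ < ‖β‖ ^ 2) (hβ : ‖β‖ < 1)
    (m : ℤ) : q ^ m ≠ β := by
  rintro rfl
  have hqn : 0 < ‖q‖ := norm_pos_iff.2 hq0
  rw [norm_zpow] at hβ hqβ
  have hq : ‖q‖ < 1 := hqβ.trans_le (pow_le_one₀ (by positivity) hβ.le)
  have hm : 0 < m := by
    by_contra! h
    exact absurd hβ (not_lt.2 (one_le_zpow_of_nonpos₀ hqn hq.le h))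
  have h1 : ‖q‖ ^ m ≤ ‖q‖ := by
    simpa using zpow_le_zpow_right_of_le_one₀ hqn hq.le (show (1 : ℤ) ≤ m by omega)
  have h2 : (‖q‖ ^ m) ^ 2 ≤ ‖q‖ ^ m := by
    rw [sq]; exact mul_le_of_le_one_left (by positivity) hβ.le
  linarith

theorem one_sub_mul_zpow_ne_zero {q β : ℂ} (h : ∀ m : ℤ, q ^ m ≠ β) (hq0 : q ≠ 0) (m : ℤ) :
    1 - β * q ^ m ≠ 0 := fun h0 => h (-m) (by
  have := zpow_ne_zero m hq0
  rw [zpow_neg]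
  refine inv_eq_of_mul_eq_one_left ?_
  linear_combination -h0)

theorem one_sub_zpow_div_ne_zero {q β : ℂ} (h : ∀ m : ℤ, q ^ m ≠ β) (hβ0 : β ≠ 0) (m : ℤ) :
    1 - q ^ m / β ≠ 0 := fun h0 => h m (by
  rw [one_sub_div hβ0, div_eq_zero_iff, or_iff_left hβ0, sub_eq_zero] at h0
  exact h0.symm)

theorem qFact_succ {a q : ℂ} (hq0 : q ≠ 0) (hq : ‖q‖ < 1) (k : ℤ) (h : 1 - a * q ^ k ≠ 0) :
    qFact a q (k + 1) = qFact a q k * (1 - a * q ^ k) := by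
  rw [qFact, qFact, qFactInf_eq_one_sub_mul (a * q ^ k) hq, mul_assoc a, ← zpow_add_one₀ hq0,
    mul_comm (1 - a * q ^ k), ← div_div, div_mul_cancel₀ _ h]

theorem qFact_zero {a q : ℂ} (h : qFactInf a q ≠ 0) : qFact a q 0 = 1 := by
  rw [qFact, zpow_zero, mul_one, div_self h]

/-- The coefficients `(β;q)_k / (q/β;q)_k` of the bilateral series. -/
def bilateralCoeff (q β : ℂ) (k : ℤ) : ℂ := qFact β q k / qFact (q / β) q k

theorem bilateralTerm_eq {q β : ℂ} (hβ0 : β ≠ 0) (n : ℤ) (θ : ℂ) (k : ℤ) :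
    bilateralTerm q (β ^ 2) (1 / β) n θ k = bilateralCoeff q β k * bilateralCoeff q β (n - k) *
      Complex.exp (Complex.I * ((n : ℂ) - 2 * (k : ℂ)) * θ) := by
  rw [bilateralTerm, bilateralCoeff, bilateralCoeff, show β ^ 2 * (1 / β) = β by field_simp,
    show q * (1 / β) = q / β by ring, div_mul_div_comm]

theorem one_sub_div_mul_zpow_ne_zero {q β : ℂ} (h : ∀ m : ℤ, q ^ m ≠ β) (hq0 : q ≠ 0)
    (hβ0 : β ≠ 0) (m : ℤ) : 1 - q / β * q ^ m ≠ 0 := by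
  rw [show q / β * q ^ m = q ^ (m + 1) / β by rw [zpow_add_one₀ hq0]; ring]
  exact one_sub_zpow_div_ne_zero h hβ0 _

theorem bilateralCoeff_succ {q β : ℂ} (hq0 : q ≠ 0) (hq : ‖q‖ < 1) (hβ0 : β ≠ 0)
    (h : ∀ m : ℤ, q ^ m ≠ β) (k : ℤ) :
    bilateralCoeff q β (k + 1) * (1 - q ^ (k + 1) / β) =
      bilateralCoeff q β k * (1 - β * q ^ k) := by
  have h1 := one_sub_div_mul_zpow_ne_zero h hq0 hβ0 k
  rw [bilateralCoeff, bilateralCoeff, qFact_succ hq0 hq k (one_sub_mul_zpow_ne_zero h hq0 k),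
    qFact_succ hq0 hq k h1, show q ^ (k + 1) / β = q / β * q ^ k by rw [zpow_add_one₀ hq0]; ring,
    mul_div_mul_comm, mul_assoc, div_mul_cancel₀ _ h1]

theorem bilateralCoeff_zero {q β : ℂ} (hq0 : q ≠ 0) (hq : ‖q‖ < 1) (hβ0 : β ≠ 0)
    (h : ∀ m : ℤ, q ^ m ≠ β) : bilateralCoeff q β 0 = 1 := by
  rw [bilateralCoeff, qFact_zero, qFact_zero, div_one]
  · exact qFactInf_ne_zero hq fun i => by simpa using one_sub_div_mul_zpow_ne_zero h hq0 hβ0 i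
  · exact qFactInf_ne_zero hq fun i => by simpa using one_sub_mul_zpow_ne_zero h hq0 i

theorem bilateralCoeff_natCast {q β : ℂ} (hq0 : q ≠ 0) (hq : ‖q‖ < 1) (hβ0 : β ≠ 0)
    (h : ∀ m : ℤ, q ^ m ≠ β) (k : ℕ) :
    bilateralCoeff q β k = qFactFin β q k * (qFactFin (q / β) q k)⁻¹ := by
  have hd : ∀ i : ℕ, 1 - q / β * q ^ i ≠ 0 := fun i => by
    simpa using one_sub_div_mul_zpow_ne_zero h hq0 hβ0 i
  induction k with
  | zero => simpa [qFactFin_zero] using bilateralCoeff_zero hq0 hq hβ0 h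
  | succ k ih =>
    have h1 := bilateralCoeff_succ hq0 hq hβ0 h k
    have h2 := hd k
    rw [ih, show q ^ ((k : ℤ) + 1) / β = q / β * q ^ k by
      rw [zpow_add_one₀ hq0, zpow_natCast]; ring, zpow_natCast] at h1
    push_cast
    refine mul_right_cancel₀ h2 ?_
    rw [h1, qFactFin_succ, qFactFin_succ, mul_inv]
    have h3 := mul_inv_cancel₀ h2
    linear_combination (-(qFactFin β q k * (1 - β * q ^ k) * (qFactFin (q / β) q k)⁻¹)) * h3

/-- Reversing the factors, 1 - βq^{-k-1} = -βq^{-k-1}(1 - q^{k+1}/β) and similarly in the numerator,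
so each downward step equals the upward one times q/β². Hence the decay at -∞. -/
theorem bilateralCoeff_neg_natCast {q β : ℂ} (hq0 : q ≠ 0) (hq : ‖q‖ < 1) (hβ0 : β ≠ 0)
    (h : ∀ m : ℤ, q ^ m ≠ β) (k : ℕ) :
    bilateralCoeff q β (-k) = (q / β ^ 2) ^ k * bilateralCoeff q β k := by
  induction k with
  | zero => simp
  | succ k ih =>
    have h1 := bilateralCoeff_succ hq0 hq hβ0 h k
    have h2 := bilateralCoeff_succ hq0 hq hβ0 h (-(k + 1 : ℤ))
    rw [show -(k + 1 : ℤ) + 1 = -k by ring, ih, zpow_neg, zpow_neg, zpow_add_one₀ hq0,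
      zpow_natCast] at h2
    rw [zpow_add_one₀ hq0, zpow_natCast] at h1
    have n1 := one_sub_mul_zpow_ne_zero h hq0 (-(k + 1 : ℤ))
    have n2 := one_sub_zpow_div_ne_zero h hβ0 ((k : ℤ) + 1)
    rw [zpow_neg, zpow_add_one₀ hq0, zpow_natCast] at n1
    rw [zpow_add_one₀ hq0, zpow_natCast] at n2
    have hQ : q ^ k ≠ 0 := pow_ne_zero k hq0
    push_cast
    refine mul_right_cancel₀ n1 ?_
    rw [← h2, pow_succ (q / β ^ 2)]
    generalize q ^ k = Q at *
    have e1 : 1 - β * (Q * q)⁻¹ = -(β * (Q * q)⁻¹) * (1 - Q * q / β) := by field_simp; ring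
    rw [e1]
    rw [show (q / β ^ 2) ^ k * (q / β ^ 2) * bilateralCoeff q β (↑k + 1) *
      (-(β * (Q * q)⁻¹) * (1 - Q * q / β)) = (q / β ^ 2) ^ k * (q / β ^ 2) * (-(β * (Q * q)⁻¹)) *
      (bilateralCoeff q β (↑k + 1) * (1 - Q * q / β)) by ring, h1]
    field_simp
    ring

theorem exists_norm_bilateralCoeff_le {q β : ℂ} (hq0 : q ≠ 0) (hq : ‖q‖ < 1) (hβ0 : β ≠ 0)
    (h : ∀ m : ℤ, q ^ m ≠ β) (hs : ‖q / β ^ 2‖ < 1) :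
    ∃ C > 0, ∀ k : ℤ, ‖bilateralCoeff q β k‖ ≤ C ∧
      ‖bilateralCoeff q β k‖ ≤ C * ‖q / β ^ 2‖ ^ (-k) := by
  obtain ⟨A, hA, hA'⟩ := exists_norm_qFactFin_le β hq
  obtain ⟨B, hB, hB'⟩ := exists_norm_inv_qFactFin_le (a := q / β) hq fun i => by
    simpa using one_sub_div_mul_zpow_ne_zero h hq0 hβ0 i
  have hpos : 0 < ‖q / β ^ 2‖ := norm_pos_iff.2 (div_ne_zero hq0 (pow_ne_zero 2 hβ0))
  have hnat : ∀ k : ℕ, ‖bilateralCoeff q β k‖ ≤ A * B := fun k => by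
    rw [bilateralCoeff_natCast hq0 hq hβ0 h, norm_mul]
    gcongr
    · exact hA' k
    · exact hB' k
  have hC : 0 < A * B := by positivity
  refine ⟨A * B, hC, fun k => ?_⟩
  obtain ⟨k, rfl | rfl⟩ := k.eq_nat_or_neg
  · refine ⟨hnat k, (hnat k).trans (le_mul_of_one_le_right hC.le ?_)⟩
    exact one_le_zpow_of_nonpos₀ hpos hs.le (by omega)
  · have h1 : ‖bilateralCoeff q β (-k)‖ ≤ A * B * ‖q / β ^ 2‖ ^ (-(-k : ℤ)) := by
      rw [bilateralCoeff_neg_natCast hq0 hq hβ0 h, norm_mul, norm_pow, neg_neg, zpow_natCast,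
        mul_comm]
      gcongr
      exact hnat k
    refine ⟨h1.trans (mul_le_of_le_one_right hC.le ?_), h1⟩
    rw [neg_neg, zpow_natCast]
    exact pow_le_one₀ hpos.le hs.le

/-- At each end one of the two indices k, n - k tends to -∞; that coefficient decays geometrically
while the other stays bounded. -/
theorem summable_norm_bilateralCoeff_mul {q β : ℂ} (hq0 : q ≠ 0) (hq : ‖q‖ < 1) (hβ0 : β ≠ 0)
    (h : ∀ m : ℤ, q ^ m ≠ β) (hs : ‖q / β ^ 2‖ < 1) (n : ℤ) :
    Summable fun k : ℤ => ‖bilateralCoeff q β k * bilateralCoeff q β (n - k)‖ := by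
  obtain ⟨C, hC, hC'⟩ := exists_norm_bilateralCoeff_le hq0 hq hβ0 h hs
  have hpos : 0 < ‖q / β ^ 2‖ := norm_pos_iff.2 (div_ne_zero hq0 (pow_ne_zero 2 hβ0))
  have hg := summable_geometric_of_lt_one hpos.le hs
  refine Summable.of_nat_of_neg ?_ ?_
  · refine Summable.of_nonneg_of_le (fun _ => norm_nonneg _) (fun k => ?_)
      (hg.mul_left (C * (C * ‖q / β ^ 2‖ ^ (-n))))
    rw [norm_mul]
    calc _ ≤ C * (C * ‖q / β ^ 2‖ ^ (-(n - k : ℤ))) := by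
          gcongr
          · exact (hC' _).1
          · exact (hC' _).2
      _ = _ := by
          rw [show -(n - k : ℤ) = -n + k by ring, zpow_add₀ hpos.ne', zpow_natCast]
          ring
  · refine Summable.of_nonneg_of_le (fun _ => norm_nonneg _) (fun k => ?_)
      (hg.mul_left (C * C))
    rw [norm_mul]
    calc _ ≤ (C * ‖q / β ^ 2‖ ^ (-(-k : ℤ))) * C := by
          gcongr
          · exact (hC' _).2
          · exact (hC' _).1
      _ = _ := by
          rw [neg_neg, zpow_natCast]
          ring

/-! ### Reduction of the orthogonality sum to the ₆φ₅ series -/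

/-- Both sides agree at j = 0 and have the same term ratio. The product comes from the parameter
1/β, the two coefficients from βq^{-s} and βq^s; changing the sign of `s` merely swaps the latter
two, so s = |m| is allowed. -/
theorem bilateralCoeff_mul_eq_wellPoised {q β : ℂ} (hq0 : q ≠ 0) (hq : ‖q‖ < 1) (hβ0 : β ≠ 0)
    (h : ∀ m : ℤ, q ^ m ≠ β) {m s : ℤ} (hs : s = m ∨ s = -m) (j : ℕ) :
    bilateralCoeff q β (m + j) * bilateralCoeff q β (m - j) *
        ∏ i ∈ Finset.range j, ((β - q ^ i) / (1 - β * q ^ (i + 1))) =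
      bilateralCoeff q β m ^ 2 * (wellPoisedCoeff q β⁻¹ (β * q ^ (-s)) j *
        wellPoisedRatio q (q ^ (-s) / β) j) := by
  induction j with
  | zero => simp [wellPoisedCoeff, wellPoisedRatio, qFactFin_zero, sq]
  | succ j ih =>
    have h1 := bilateralCoeff_succ hq0 hq hβ0 h (m + j)
    have h2 := bilateralCoeff_succ hq0 hq hβ0 h (m - (j + 1 : ℕ))
    rw [show m - (j + 1 : ℕ) + 1 = m - j by push_cast; ring] at h2
    have n1 := one_sub_zpow_div_ne_zero h hβ0 (m + j + 1)
    have n2 := one_sub_mul_zpow_ne_zero h hq0 (m - (j + 1 : ℕ))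
    have e1 : m + (j + 1 : ℕ) = m + j + 1 := by push_cast; ring
    have h1' := eq_div_of_mul_eq n1 h1
    have h2' := eq_div_of_mul_eq n2 h2.symm
    -- Equality of the term ratios, a rational identity in q^m and q^j once the sign of `s` is
    -- chosen.
    have hr : (1 - β * q ^ (m + j)) / (1 - q ^ (m + j + 1) / β) *
        ((1 - q ^ (m - j) / β) / (1 - β * q ^ (m - (j + 1 : ℕ)))) *
        ((β - q ^ j) / (1 - β * q ^ (j + 1))) =
        q / (β⁻¹ * (β * q ^ (-s))) * ((1 - β⁻¹ * q ^ j) * (1 - β * q ^ (-s) * q ^ j)) /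
          ((1 - q ^ (j + 1) / β⁻¹) * (1 - q ^ (j + 1) / (β * q ^ (-s)))) *
          ((q ^ (-s) / β - q ^ j) / (1 - q ^ (j + 1) * (q ^ (-s) / β))) := by
      have n3 := one_sub_mul_zpow_ne_zero h hq0 (j + 1 : ℕ)
      have ht : q ^ m ≠ 0 := zpow_ne_zero m hq0
      have hQ : q ^ j ≠ 0 := pow_ne_zero j hq0
      have e2 : q ^ (m - (j + 1 : ℕ)) = q ^ m / (q ^ j * q) := by
        rw [zpow_sub₀ hq0, zpow_natCast, pow_succ]
      rw [zpow_natCast] at n3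
      rw [e2] at n2 ⊢
      rw [zpow_add_one₀ hq0, zpow_add₀ hq0, zpow_natCast] at n1
      rw [zpow_add_one₀ hq0, zpow_add₀ hq0, zpow_natCast, zpow_sub₀ hq0, zpow_natCast]
      rw [pow_succ] at n3 ⊢
      have hs' : q ^ (-s) = (q ^ m)⁻¹ ∨ q ^ (-s) = q ^ m := by
        rcases hs with rfl | rfl
        · left; rw [zpow_neg]
        · right; rw [neg_neg]
      generalize q ^ (-s) = S at *
      generalize q ^ m = t at *
      generalize q ^ j = Q at *
      have k1 : β - t * Q * q ≠ 0 := by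
        rw [one_sub_div hβ0] at n1; exact (div_ne_zero_iff.1 n1).1
      have k2 : Q * q - β * t ≠ 0 := by
        rw [mul_div_assoc', one_sub_div (mul_ne_zero hQ hq0)] at n2; exact (div_ne_zero_iff.1 n2).1
      have d1 : 1 - t * Q * q / β = (β - t * Q * q) / β := by field_simp
      have d2 : 1 - β * (t / (Q * q)) = (Q * q - β * t) / (Q * q) := by field_simp
      have d3 : 1 - Q * q / β⁻¹ = 1 - β * (Q * q) := by field_simp
      rcases hs' with rfl | rfl
      · have d4 : 1 - Q * q / (β * t⁻¹) = (β - t * Q * q) / β := by field_simp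
        have d5 : 1 - Q * q * (t⁻¹ / β) = -(Q * q - β * t) / (β * t) := by field_simp; ring
        rw [d1, d2, d3, d4, d5]
        generalize β - t * Q * q = D1 at *
        generalize Q * q - β * t = D2 at *
        generalize 1 - β * (Q * q) = D3 at *
        field_simp
        ring
      · have d4 : 1 - Q * q / (β * S) = -(Q * q - β * S) / (β * S) := by field_simp; ring
        have d5 : 1 - Q * q * (S / β) = (β - S * Q * q) / β := by field_simp
        rw [d1, d2, d3, d4, d5]
        generalize β - S * Q * q = D1 at *
        generalize Q * q - β * S = D2 at *
        generalize 1 - β * (Q * q) = D3 at *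
        field_simp
        ring
    rw [Finset.prod_range_succ, wellPoisedCoeff_succ, wellPoisedRatio_succ, e1, h1', h2']
    calc _ = (bilateralCoeff q β (m + j) * bilateralCoeff q β (m - j) *
          ∏ i ∈ Finset.range j, ((β - q ^ i) / (1 - β * q ^ (i + 1)))) *
          ((1 - β * q ^ (m + j)) / (1 - q ^ (m + j + 1) / β) *
          ((1 - q ^ (m - j) / β) / (1 - β * q ^ (m - (j + 1 : ℕ)))) *
          ((β - q ^ j) / (1 - β * q ^ (j + 1)))) := by simp only [div_eq_mul_inv]; ring
      _ = _ := by rw [ih, hr]; simp only [div_eq_mul_inv]; ring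

theorem norm_lt_one_of_norm_lt_sq {q β : ℂ} (hqβ : ‖q‖ < ‖β‖ ^ 2) (hβ : ‖β‖ < 1) : ‖q‖ < 1 :=
  hqβ.trans_le (pow_le_one₀ (norm_nonneg β) hβ.le)

theorem ne_zero_of_norm_lt_sq {q β : ℂ} (hqβ : ‖q‖ < ‖β‖ ^ 2) : β ≠ 0 := by
  rintro rfl
  have := norm_nonneg q
  simp at hqβ
  linarith

theorem norm_div_sq_lt_one {q β : ℂ} (hqβ : ‖q‖ < ‖β‖ ^ 2) : ‖q / β ^ 2‖ < 1 := by
  have hβn : 0 < ‖β‖ := norm_pos_iff.2 (ne_zero_of_norm_lt_sq hqβ)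
  rw [norm_div, norm_pow]
  exact (div_lt_one (by positivity)).2 hqβ

theorem norm_div_lt_one {q β : ℂ} (hqβ : ‖q‖ < ‖β‖ ^ 2) (hβ : ‖β‖ < 1) : ‖q / β‖ < 1 := by
  have hβn : 0 < ‖β‖ := norm_pos_iff.2 (ne_zero_of_norm_lt_sq hqβ)
  rw [norm_div]
  refine (div_lt_one hβn).2 (hqβ.trans ?_)
  rw [sq]
  exact mul_lt_of_lt_one_left hβn hβ

/-- The values of the parameters for which the `₆φ₅` series is needed. -/
theorem wellPoised_parameters {q β : ℂ} (hq0 : q ≠ 0) (hqβ : ‖q‖ < ‖β‖ ^ 2) (hβ : ‖β‖ < 1)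
    (M : ℕ) :
    (∀ i : ℕ, 1 - q ^ (i + 1) / β⁻¹ ≠ 0) ∧
    (∀ i : ℕ, 1 - q ^ (i + 1) / (β * q ^ (-(M : ℤ))) ≠ 0) ∧
    (∀ i : ℕ, 1 - q ^ (i + 1) * (q ^ (-(M : ℤ)) / β) ≠ 0) ∧
    q / (β⁻¹ * (β * q ^ (-(M : ℤ)))) = q ^ (M + 1) ∧
    q / (β⁻¹ * (β * q ^ (-(M : ℤ)))) * (q ^ (-(M : ℤ)) / β) = q / β := by
  have h := zpow_ne_of_norm_lt_sq hq0 hqβ hβ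
  have hβ0 := ne_zero_of_norm_lt_sq hqβ
  have hM : q ^ M ≠ 0 := pow_ne_zero M hq0
  refine ⟨fun i => ?_, fun i => ?_, fun i => ?_, ?_, ?_⟩
  · rw [div_inv_eq_mul, mul_comm, ← zpow_natCast]
    exact one_sub_mul_zpow_ne_zero h hq0 _
  · have e : q ^ (i + 1) / (β * q ^ (-(M : ℤ))) = q ^ ((i + 1 + M : ℕ) : ℤ) / β := by
      rw [zpow_natCast, zpow_neg, zpow_natCast, pow_add]; field_simp; ring
    rw [e]; exact one_sub_zpow_div_ne_zero h hβ0 _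
  · have e : q ^ (i + 1) * (q ^ (-(M : ℤ)) / β) = q ^ ((i + 1 : ℕ) - M : ℤ) / β := by
      rw [sub_eq_add_neg, zpow_add₀ hq0, zpow_natCast]; ring
    rw [e]; exact one_sub_zpow_div_ne_zero h hβ0 _
  · rw [zpow_neg, zpow_natCast, pow_succ]; field_simp
  · rw [zpow_neg, zpow_natCast]; field_simp

/-- The summand is even in j, as w(1/z) = w(z), so the bilateral sum folds onto j ≥ 0. Taking |m|
instead of m makes q/(bc) = q^{|m|+1}, of norm below 1, as the ₆φ₅ evaluation demands. -/
theorem tsum_bilateralCoeff_mul_laurentCoeff {q β : ℂ} (hq0 : q ≠ 0) (hqβ : ‖q‖ < ‖β‖ ^ 2)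
    (hβ : ‖β‖ < 1) (m : ℤ) :
    ∑' j : ℤ, bilateralCoeff q β (m + j) * bilateralCoeff q β (m - j) *
        laurentCoeff (ultraWeight q β) j =
      2 * (bilateralCoeff q β m ^ 2 * laurentCoeff (ultraKernel q β) 0 *
        wellPoisedSum q β⁻¹ (β * q ^ (-(m.natAbs : ℤ))) (q ^ (-(m.natAbs : ℤ)) / β)) := by
  have h := zpow_ne_of_norm_lt_sq hq0 hqβ hβ
  have hβ0 := ne_zero_of_norm_lt_sq hqβ
  have hq := norm_lt_one_of_norm_lt_sq hqβ hβ
  obtain ⟨p1, p2, p3, p4, p5⟩ := wellPoised_parameters hq0 hqβ hβ m.natAbs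
  set c := β * q ^ (-(m.natAbs : ℤ)) with hc
  set e := q ^ (-(m.natAbs : ℤ)) / β with he
  have he0 : e ≠ 0 := div_ne_zero (zpow_ne_zero _ hq0) hβ0
  set A := bilateralCoeff q β m ^ 2 * laurentCoeff (ultraKernel q β) 0 with hA
  set f : ℤ → ℂ := fun j => bilateralCoeff q β (m + j) * bilateralCoeff q β (m - j) *
        laurentCoeff (ultraWeight q β) j with hf
  have hfn : ∀ j : ℕ, f j = A * wellPoisedTerm q β⁻¹ c e j := fun j => by
    have hs : (m.natAbs : ℤ) = m ∨ (m.natAbs : ℤ) = -m := by omega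
    have := bilateralCoeff_mul_eq_wellPoised hq0 hq hβ0 h hs j
    rw [← hc, ← he] at this
    simp only [hf, laurentCoeff_ultraWeight_natCast hq0 hq hβ, hA, wellPoisedTerm]
    linear_combination (laurentCoeff (ultraKernel q β) 0 * (1 + q ^ j)) * this
  have hneg : ∀ j : ℤ, f (-j) = f j := fun j => by
    simp only [hf, laurentCoeff_ultraWeight_neg]
    rw [sub_neg_eq_add, ← sub_eq_add_neg, mul_comm (bilateralCoeff q β (m - j))]
  have hS := summable_wellPoisedTerm hq he0 p1 p2 p3 (by
    rw [p5]; exact norm_div_lt_one hqβ hβ) 0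
  simp only [pow_zero, one_mul] at hS
  have hf1 : Summable fun j : ℕ => f ((j : ℤ) + 1) := by
    refine (hS.mul_left A).congr fun j => ?_
    rw [← hfn]; push_cast; rfl
  have hf0 : Summable fun j : ℕ => f (j : ℤ) := by
    refine (summable_nat_add_iff 1).1 (hf1.congr fun j => ?_)
    push_cast; rfl
  have hsum : ∑' j : ℕ, f ((j : ℤ) + 1) = A * ∑' k : ℕ, wellPoisedTerm q β⁻¹ c e (k + 1) := by
    rw [← tsum_mul_left]
    refine tsum_congr fun j => ?_
    rw [← hfn]; push_cast; rfl
  -- The factor 1 + q^0 = 2 gives the unpaired central term the same weight 2 as the pairs ±j.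
  have h0 : f 0 = 2 * A := by
    have := hfn 0
    rw [Nat.cast_zero] at this
    rw [this]
    simp [wellPoisedTerm, wellPoisedCoeff, wellPoisedRatio, qFactFin_zero]
    ring
  rw [tsum_of_nat_of_neg_add_one hf0 (hf1.congr fun j => (hneg _).symm), hf0.tsum_eq_zero_add]
  simp only [hneg]
  push_cast
  rw [h0, hsum, wellPoisedSum]
  ring

/-- The orthogonality sum behind the integral evaluation. -/
theorem tsum_bilateralCoeff_mul_laurentCoeff_eq {q β : ℂ} (hq0 : q ≠ 0) (hqβ : ‖q‖ < ‖β‖ ^ 2)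
    (hβ : ‖β‖ < 1) (m : ℤ) :
    ∑' j : ℤ, bilateralCoeff q β (m + j) * bilateralCoeff q β (m - j) *
        laurentCoeff (ultraWeight q β) j =
      2 * ((qFactInf q q ^ 2 * (qFactInf β q * qFactInf (q / β ^ 2) q)) /
        (qFactInf (q / β) q ^ 3 * qFactInf (β ^ 2) q) * (if m = 0 then 1 else 0)) := by
  have h := zpow_ne_of_norm_lt_sq hq0 hqβ hβ
  have hβ0 := ne_zero_of_norm_lt_sq hqβ
  have hq := norm_lt_one_of_norm_lt_sq hqβ hβ
  have hqβ1 := norm_div_lt_one hqβ hβ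
  obtain ⟨p1, p2, p3, p4, p5⟩ := wellPoised_parameters hq0 hqβ hβ m.natAbs
  have hqM : q ^ (-(m.natAbs : ℤ)) ≠ 0 := zpow_ne_zero _ hq0
  have key := wellPoisedSum_eq hq0 hq (inv_ne_zero hβ0) (mul_ne_zero hβ0 hqM)
    (div_ne_zero hqM hβ0) p1 p2 p3 (by rw [p5]; exact hqβ1) (by
      rw [p4, norm_pow]; exact pow_lt_one₀ (norm_nonneg q) hq (by omega))
  rw [p5, p4] at key
  rw [tsum_bilateralCoeff_mul_laurentCoeff hq0 hqβ hβ]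
  have n1 : qFactInf (q / β⁻¹) q ≠ 0 := qFactInf_ne_zero hq fun i => by
    rw [show q / β⁻¹ * q ^ i = q ^ (i + 1) / β⁻¹ by ring]; exact p1 i
  have n2 : qFactInf (q / (β * q ^ (-(m.natAbs : ℤ)))) q ≠ 0 := qFactInf_ne_zero hq fun i => by
    rw [div_mul_eq_mul_div, ← pow_succ']; exact p2 i
  have n3 : qFactInf (q * (q ^ (-(m.natAbs : ℤ)) / β)) q ≠ 0 := qFactInf_ne_zero hq fun i => by
    rw [mul_right_comm, ← pow_succ']; exact p3 i
  have n4 : qFactInf (q / β) q ≠ 0 := qFactInf_ne_zero_of_norm_lt_one hq hqβ1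
  congr 1
  split_ifs with hm
  · subst hm
    simp only [Int.natAbs_zero, Nat.cast_zero, neg_zero, zpow_zero, mul_one, zero_add,
      pow_one] at key n2 n3 ⊢
    rw [bilateralCoeff_zero hq0 hq hβ0 h, laurentCoeff_ultraKernel_zero hq0 hq hβ]
    have e1 : q / β⁻¹ = q * β := by field_simp
    have e2 : q * (1 / β) = q / β := by ring
    have e3 : q / β / β⁻¹ = q := by field_simp
    have e4 : q / β / β = q / β ^ 2 := by field_simp
    rw [e2, e1, e3, e4] at key
    rw [e1] at n1
    have n5 := qFactInf_ne_zero_of_norm_lt_one hq hq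
    have n6 : qFactInf (β ^ 2) q ≠ 0 := qFactInf_ne_zero_of_norm_lt_one hq (by
      rw [norm_pow]; exact pow_lt_one₀ (norm_nonneg β) hβ two_ne_zero)
    rw [one_pow, one_mul, div_mul_eq_mul_div, div_eq_div_iff (mul_ne_zero n5 n6)
      (mul_ne_zero (pow_ne_zero 3 n4) n6)]
    linear_combination (qFactInf β q * qFactInf (β ^ 2) q) * key
  -- Here qe/b = q^{1-|m|}; for m ≠ 0 its factor of index |m| - 1 is 1 - 1. This is where
  -- orthogonality arises.
  · have hz : qFactInf (q * (q ^ (-(m.natAbs : ℤ)) / β) / β⁻¹) q = 0 := by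
      obtain ⟨M, hM⟩ : ∃ M : ℕ, m.natAbs = M + 1 := ⟨m.natAbs - 1, by omega⟩
      have e : q * (q ^ (-(m.natAbs : ℤ)) / β) / β⁻¹ * q ^ M = 1 := by
        rw [hM, zpow_neg, zpow_natCast, pow_succ]
        have := pow_ne_zero M hq0
        field_simp
      rw [qFactInf_eq_qFactFin_mul _ hq M, e, qFactInf_one_left hq, mul_zero]
    rw [hz, zero_mul, mul_zero] at key
    have : wellPoisedSum q β⁻¹ (β * q ^ (-(m.natAbs : ℤ))) (q ^ (-(m.natAbs : ℤ)) / β) = 0 :=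
      (mul_eq_zero.1 key).resolve_left
        (mul_ne_zero (mul_ne_zero n1 n2) (mul_ne_zero n3 n4))
    rw [this, mul_zero, mul_zero]

/-! ### The substitution x = cos θ and termwise integration -/

/-- Change of variables for the monotone function arccos: the sign of its derivative on the open
interval suffices, so the endpoint singularities of 1/√(1 - x²) need no separate estimate. -/
theorem intervalIntegrable_comp_arccos {g : ℝ → ℂ} (hg : Continuous g) :
    IntervalIntegrable (fun x : ℝ => g (Real.arccos x) * ((1 / Real.sqrt (1 - x ^ 2) : ℝ) : ℂ))
      MeasureTheory.volume (-1) 1 := by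
  have h := (intervalIntegral.integrable_deriv_smul_comp_iff_of_deriv_nonpos (a := -1) (b := 1)
    (f := Real.arccos) (f' := fun x => -(1 / √(1 - x ^ 2))) (g := g)
    Real.continuous_arccos.continuousOn
    (fun x hx => Real.hasDerivAt_arccos (by rintro rfl; simp at hx) (by rintro rfl; simp at hx))
    (fun x hx => by simp)).2 (hg.intervalIntegrable _ _)
  refine (h.neg).congr fun x _ => ?_
  simp [mul_comm]

theorem integral_comp_arccos (g : ℝ → ℂ) :
    ∫ x in (-1 : ℝ)..1, g (Real.arccos x) * ((1 / Real.sqrt (1 - x ^ 2) : ℝ) : ℂ) =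
      ∫ θ in 0..Real.pi, g θ := by
  have h := intervalIntegral.integral_deriv_smul_comp_of_deriv_nonpos (a := -1) (b := 1)
    (f := Real.arccos) (f' := fun x => -(1 / √(1 - x ^ 2))) (g := g)
    Real.continuous_arccos.continuousOn
    (fun x hx => Real.hasDerivAt_arccos (by rintro rfl; simp at hx) (by rintro rfl; simp at hx))
    (fun x hx => by simp)
  rw [Real.arccos_neg_one, Real.arccos_one] at h
  rw [intervalIntegral.integral_symm Real.pi 0, ← h, ← intervalIntegral.integral_neg]
  refine intervalIntegral.integral_congr fun x _ => ?_
  simp [mul_comm]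

/-- The weight as a function of the angle. -/
def angularWeight (q β : ℂ) (θ : ℝ) : ℂ := ultraWeight q β (circleMap 0 1 (2 * θ))

theorem circleMap_two_mul (θ : ℝ) :
    circleMap 0 1 (2 * θ) = Complex.exp (2 * Complex.I * (θ : ℂ)) := by
  simp only [circleMap, zero_add, Complex.ofReal_one, one_mul]
  congr 1
  push_cast
  ring

theorem ultrasphericalRatio_eq (q β : ℂ) (x : ℝ) :
    ultrasphericalRatio q β x = angularWeight q β (Real.arccos x) := by
  simp only [ultrasphericalRatio, angularWeight, ultraWeight, circleMap_two_mul, Complex.exp_neg]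

theorem continuous_angularWeight {q β : ℂ} (hq : ‖q‖ < 1) (hβ : ‖β‖ < 1) :
    Continuous (angularWeight q β) :=
  (continuousOn_ultraWeight hq hβ).comp_continuous
    ((continuous_circleMap 0 1).comp (continuous_const_mul 2))
    fun _ => circleMap_mem_sphere 0 zero_le_one _

theorem angularWeight_pi_sub (q β : ℂ) (θ : ℝ) :
    angularWeight q β (Real.pi - θ) = angularWeight q β θ := by
  have h : circleMap 0 1 (2 * (Real.pi - θ)) = (circleMap 0 1 (2 * θ))⁻¹ := by
    rw [circleMap_zero_inv, inv_one, mul_sub, sub_eq_neg_add, periodic_circleMap 0 1]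
  rw [angularWeight, h, ultraWeight_inv, angularWeight]

theorem norm_exp_angle (n k : ℤ) (θ : ℝ) :
    ‖Complex.exp (Complex.I * ((n : ℂ) - 2 * (k : ℂ)) * (θ : ℂ))‖ = 1 := by
  rw [show Complex.I * ((n : ℂ) - 2 * (k : ℂ)) * (θ : ℂ) =
    (((n - 2 * k) * θ : ℝ) : ℂ) * Complex.I by push_cast; ring, Complex.norm_exp_ofReal_mul_I]

theorem norm_bilateralTerm {q β : ℂ} (hβ0 : β ≠ 0) (n : ℤ) (θ : ℝ) (k : ℤ) :
    ‖bilateralTerm q (β ^ 2) (1 / β) n θ k‖ =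
      ‖bilateralCoeff q β k * bilateralCoeff q β (n - k)‖ := by
  rw [bilateralTerm_eq hβ0, norm_mul, norm_exp_angle, mul_one]

theorem summable_norm_bilateralTerm {q β : ℂ} (hq0 : q ≠ 0) (hqβ : ‖q‖ < ‖β‖ ^ 2) (hβ : ‖β‖ < 1)
    (n : ℤ) (θ : ℝ) :
    Summable fun k : ℤ => ‖bilateralTerm q (β ^ 2) (1 / β) n (θ : ℂ) k‖ := by
  have hβ0 := ne_zero_of_norm_lt_sq hqβ
  simp only [norm_bilateralTerm hβ0]
  exact summable_norm_bilateralCoeff_mul hq0 (norm_lt_one_of_norm_lt_sq hqβ hβ) hβ0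
    (zpow_ne_of_norm_lt_sq hq0 hqβ hβ) (norm_div_sq_lt_one hqβ) n

theorem continuous_bilateralTerm (q β γ : ℂ) (n k : ℤ) :
    Continuous fun θ : ℝ => bilateralTerm q β γ n (θ : ℂ) k := by
  unfold bilateralTerm
  fun_prop

theorem continuous_tsum_bilateralTerm {q β : ℂ} (hq0 : q ≠ 0) (hqβ : ‖q‖ < ‖β‖ ^ 2)
    (hβ : ‖β‖ < 1) (n : ℤ) :
    Continuous fun θ : ℝ => ∑' k : ℤ, bilateralTerm q (β ^ 2) (1 / β) n (θ : ℂ) k := by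
  have hβ0 := ne_zero_of_norm_lt_sq hqβ
  have hs := summable_norm_bilateralTerm hq0 hqβ hβ n 0
  simp only [norm_bilateralTerm hβ0] at hs
  exact continuous_tsum (fun k => continuous_bilateralTerm _ _ _ n k) hs
    fun k θ => (norm_bilateralTerm hβ0 n θ k).le

/-- The swap k ↔ n - k undoes the reversal of θ, leaving the factor e^{-i(n-2k)π}, which is -1 for
odd n. -/
theorem tsum_bilateralTerm_pi_sub {q β : ℂ} (hβ0 : β ≠ 0) {n : ℤ} (hn : Odd n) (θ : ℝ) :
    ∑' k : ℤ, bilateralTerm q (β ^ 2) (1 / β) n ((Real.pi - θ : ℝ) : ℂ) k =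
      -∑' k : ℤ, bilateralTerm q (β ^ 2) (1 / β) n (θ : ℂ) k := by
  rw [← tsum_neg, ← (Equiv.subLeft n).tsum_eq]
  refine tsum_congr fun k => ?_
  obtain ⟨m, rfl⟩ := hn
  rw [bilateralTerm_eq hβ0, bilateralTerm_eq hβ0]
  simp only [Equiv.subLeft_apply, sub_sub_cancel]
  rw [mul_comm (bilateralCoeff q β (2 * m + 1 - k)), ← mul_neg]
  congr 1
  have e : Complex.I * (((2 * m + 1 : ℤ) : ℂ) - 2 * ((2 * m + 1 - k : ℤ) : ℂ)) *
      ((Real.pi - θ : ℝ) : ℂ) =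
      Complex.I * (((2 * m + 1 : ℤ) : ℂ) - 2 * (k : ℂ)) * (θ : ℂ) + Real.pi * Complex.I +
        ((k - m - 1 : ℤ) : ℂ) * (2 * Real.pi * Complex.I) := by
    push_cast; ring
  rw [e, Complex.exp_add, Complex.exp_int_mul_two_pi_mul_I, Complex.exp_add, Complex.exp_pi_mul_I]
  ring

/-- Doubling the angle sends [0,π] onto one full turn; the Jacobian 1/2 against the normalisation 2π
leaves π. -/
theorem integral_exp_mul_angularWeight (q β : ℂ) (j : ℤ) :
    ∫ θ in 0..Real.pi, Complex.exp (Complex.I * (-(2 * (j : ℂ))) * (θ : ℂ)) *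
      angularWeight q β θ = Real.pi * laurentCoeff (ultraWeight q β) j := by
  have h := intervalIntegral.integral_comp_mul_left (a := 0) (b := Real.pi)
    (fun θ => ultraWeight q β (circleMap 0 1 θ) * circleMap 0 1 θ ^ (-j)) two_ne_zero
  rw [mul_zero] at h
  have hp : (Real.pi : ℂ) ≠ 0 := Complex.ofReal_ne_zero.2 Real.pi_ne_zero
  rw [laurentCoeff_eq_integral, ← smul_right_injective ℂ (two_ne_zero (α := ℝ)) |>.eq_iff]
  rw [show ∫ θ in 0..Real.pi, Complex.exp (Complex.I * (-(2 * (j : ℂ))) * (θ : ℂ)) *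
      angularWeight q β θ = ∫ θ in 0..Real.pi,
        ultraWeight q β (circleMap 0 1 (2 * θ)) * circleMap 0 1 (2 * θ) ^ (-j) from
    intervalIntegral.integral_congr fun θ _ => by
      rw [mul_comm, angularWeight]
      congr 1
      rw [circleMap_two_mul, ← Complex.exp_int_mul]
      congr 1
      push_cast
      ring]
  rw [h, smul_inv_smul₀ two_ne_zero, Complex.real_smul]
  push_cast
  field_simp

/-- For real θ the norm of each term of the series is independent of θ, so one summable sequence
times the continuous weight dominates. -/
theorem hasSum_integral_bilateralTerm {q β : ℂ} (hq0 : q ≠ 0) (hqβ : ‖q‖ < ‖β‖ ^ 2)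
    (hβ : ‖β‖ < 1) (n : ℤ) :
    HasSum (fun k : ℤ => ∫ θ in 0..Real.pi,
        bilateralTerm q (β ^ 2) (1 / β) n (θ : ℂ) k * angularWeight q β θ)
      (∫ θ in 0..Real.pi, (∑' k : ℤ, bilateralTerm q (β ^ 2) (1 / β) n (θ : ℂ) k) *
        angularWeight q β θ) := by
  have hβ0 := ne_zero_of_norm_lt_sq hqβ
  have hw := continuous_angularWeight (norm_lt_one_of_norm_lt_sq hqβ hβ) hβ
  have hs := fun θ => summable_norm_bilateralTerm hq0 hqβ hβ n θ
  refine intervalIntegral.hasSum_integral_of_dominated_convergence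
    (fun k θ => ‖bilateralCoeff q β k * bilateralCoeff q β (n - k)‖ * ‖angularWeight q β θ‖)
    (fun k => ((continuous_bilateralTerm _ _ _ n k).mul hw).aestronglyMeasurable)
    (fun k => Eventually.of_forall fun θ _ => ?_) (Eventually.of_forall fun θ _ => ?_) ?_
    (Eventually.of_forall fun θ _ => (hs θ).of_norm.hasSum.mul_right _)
  · rw [norm_mul, norm_bilateralTerm hβ0]
  · have := hs θ
    simp only [norm_bilateralTerm hβ0] at this
    exact this.mul_right _
  · simp only [tsum_mul_right]
    exact (hw.norm.const_mul _).intervalIntegrable _ _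

theorem integral_tsum_bilateralTerm_even {q β : ℂ} (hq0 : q ≠ 0) (hqβ : ‖q‖ < ‖β‖ ^ 2)
    (hβ : ‖β‖ < 1) (m : ℤ) :
    ∫ θ in 0..Real.pi, (∑' k : ℤ, bilateralTerm q (β ^ 2) (1 / β) (2 * m) (θ : ℂ) k) *
        angularWeight q β θ =
      Real.pi * ∑' j : ℤ, bilateralCoeff q β (m + j) * bilateralCoeff q β (m - j) *
        laurentCoeff (ultraWeight q β) j := by
  have hβ0 := ne_zero_of_norm_lt_sq hqβ
  -- Centring at k = m + j turns the exponential into e^{-2ijθ}, which picks out w_j.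
  rw [← (hasSum_integral_bilateralTerm hq0 hqβ hβ (2 * m)).tsum_eq, ← (Equiv.addLeft m).tsum_eq,
    ← tsum_mul_left]
  refine tsum_congr fun j => ?_
  rw [Equiv.coe_addLeft, mul_left_comm, ← integral_exp_mul_angularWeight,
    ← intervalIntegral.integral_const_mul]
  refine intervalIntegral.integral_congr fun θ _ => ?_
  simp only
  rw [bilateralTerm_eq hβ0, show 2 * m - (m + j) = m - j by ring, mul_assoc]
  congr 4
  push_cast
  ring

theorem integral_tsum_bilateralTerm_odd {q β : ℂ} (hβ0 : β ≠ 0) {n : ℤ} (hn : Odd n) :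
    ∫ θ in 0..Real.pi, (∑' k : ℤ, bilateralTerm q (β ^ 2) (1 / β) n (θ : ℂ) k) *
        angularWeight q β θ = 0 := by
  have h := intervalIntegral.integral_comp_sub_left (a := 0) (b := Real.pi)
    (fun θ : ℝ => (∑' k : ℤ, bilateralTerm q (β ^ 2) (1 / β) n (θ : ℂ) k) *
      angularWeight q β θ) Real.pi
  simp only [tsum_bilateralTerm_pi_sub hβ0 hn, angularWeight_pi_sub, neg_mul,
    intervalIntegral.integral_neg, sub_self, sub_zero] at h
  exact self_eq_neg.1 h.symm

theorem bilateralUltraspherical_eq_tsum_arccos (q β γ : ℂ) (n : ℤ) {x : ℝ}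
    (hx : x ∈ Set.Icc (-1 : ℝ) 1) :
    bilateralUltraspherical q β γ n (x : ℂ) =
      ∑' k : ℤ, bilateralTerm q β γ n (Real.arccos x : ℂ) k := by
  rw [← bilateralUltraspherical_cos, ← Complex.ofReal_cos, Real.cos_arccos hx.1 hx.2]

end

/-! ### The integral evaluation -/

theorem mainTheorem5 (q β : ℂ) (hq : 0 < ‖q‖) (hqβ : ‖q‖ < ‖β‖ ^ 2) (hβ : ‖β‖ < 1) (n : ℤ) :
    (∀ θ : ℝ, Summable fun k : ℤ => bilateralTerm q (β ^ 2) (1 / β) n (θ : ℂ) k) ∧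
    IntervalIntegrable
      (fun x : ℝ => bilateralUltraspherical q (β ^ 2) (1 / β) n (x : ℂ) *
        ultrasphericalRatio q β x * ((1 / Real.sqrt (1 - x ^ 2) : ℝ) : ℂ))
      MeasureTheory.volume (-1) 1 ∧
    1 / (2 * (Real.pi : ℂ)) *
      (∫ x in (-1 : ℝ)..1, bilateralUltraspherical q (β ^ 2) (1 / β) n (x : ℂ) *
        ultrasphericalRatio q β x * ((1 / Real.sqrt (1 - x ^ 2) : ℝ) : ℂ)) =
    (qFactInf q q ^ 2 * (qFactInf β q * qFactInf (q / β ^ 2) q)) /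
      (qFactInf (q / β) q ^ 3 * qFactInf (β ^ 2) q) * (if n = 0 then 1 else 0) := by
  have hq0 : q ≠ 0 := norm_pos_iff.1 hq
  have hβ0 := ne_zero_of_norm_lt_sq hqβ
  have hp : (Real.pi : ℂ) ≠ 0 := Complex.ofReal_ne_zero.2 Real.pi_ne_zero
  set g : ℝ → ℂ := fun θ => (∑' k : ℤ, bilateralTerm q (β ^ 2) (1 / β) n (θ : ℂ) k) *
    angularWeight q β θ with hg
  have hgc : Continuous g := (continuous_tsum_bilateralTerm hq0 hqβ hβ n).mul
    (continuous_angularWeight (norm_lt_one_of_norm_lt_sq hqβ hβ) hβ)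
  have hx : ∀ x ∈ Set.Icc (-1 : ℝ) 1,
      g (Real.arccos x) * ((1 / Real.sqrt (1 - x ^ 2) : ℝ) : ℂ) =
      bilateralUltraspherical q (β ^ 2) (1 / β) n (x : ℂ) *
        ultrasphericalRatio q β x * ((1 / Real.sqrt (1 - x ^ 2) : ℝ) : ℂ) := fun x hx => by
    rw [bilateralUltraspherical_eq_tsum_arccos _ _ _ _ hx, ultrasphericalRatio_eq]
  have huIcc : Set.uIcc (-1 : ℝ) 1 = Set.Icc (-1) 1 := Set.uIcc_of_le (by norm_num)
  refine ⟨fun θ => (summable_norm_bilateralTerm hq0 hqβ hβ n θ).of_norm, ?_, ?_⟩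
  · refine (intervalIntegrable_comp_arccos hgc).congr fun x h => hx x ?_
    rw [← huIcc]
    exact Set.uIoc_subset_uIcc h
  · rw [← intervalIntegral.integral_congr (fun x h => hx x (huIcc ▸ h)), integral_comp_arccos]
    -- Odd n vanishes by symmetry; for n = 2m the constants π and 2 cancel the prefactor 1/(2π).
    rcases Int.even_or_odd' n with ⟨m, rfl | rfl⟩
    · simp only [hg]
      rw [integral_tsum_bilateralTerm_even hq0 hqβ hβ,
        tsum_bilateralCoeff_mul_laurentCoeff_eq hq0 hqβ hβ]
      have : (2 * m = 0) = (m = 0) := by simp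
      simp only [this]
      field_simp
    · simp only [hg]
      rw [integral_tsum_bilateralTerm_odd hβ0 ⟨m, rfl⟩, if_neg (by omega)]
      simp
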